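/- Let $(M,\mathcal T)$ be a triangulated closed connected oriented 3-manifold: $M$ is a closed connected topological 3-manifold that is identified, by a homeomorphism, with a quotient $X/\!\sim$, where $X$ is a disjoint union of finitely many oriented tetrahedra all of whose codimension-1 faces are identified in pairs by orientation reversing affine homeomorphisms (two faces of one tetrahedron may be identified with each other). The vertices and edges of $\mathcal T$ are the equivalence classes of vertices and edges of the tetrahedra of $X$. Each tetrahedron $\sigma$ has three quads, which correspond to its three pairs of opposite edges; a quad faces the two edges of its pair. The orientation of $\sigma$ determines a cyclic order $q\to q'\to q''\to q$ of them, namely the cyclic order, viewed from any vertex, of the three edges of $\sigma$ at that vertex. A solution of Thurston's equation on $\mathcal T$ in a commutative ring $R$ with identity assigns to each quad $q$ of $\mathcal T$ an element $x(q)\in R$ such that $x(q')(1-x(q))=1$ whenever $q\to q'$, and $\prod_{q\sim e}x(q)=1$ for each edge $e$ of $\mathcal T$, where the product runs over the edges of tetrahedra of $X$ that belong to the class $e$, with $q$ the quad facing that edge. For a tetrahedron $\sigma$ with quads $q\to q'\to q''\to q$ let $\mathcal R(\sigma)=\mathbf Z[q,q',q'']/\big(q'(1-q)-1,\ q''(1-q')-1,\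 q(1-q'')-1\big)$. The Thurston ring $\mathcal R(\mathcal T)$ is the quotient of the tensor product $\bigotimes_\sigma\mathcal R(\sigma)$ over $\mathbf Z$, over all tetrahedra $\sigma$ of $\mathcal T$, by the ideal generated by the elements $\prod_{q\sim e}q-1$ for all edges $e$ of $\mathcal T$. **Theorem.** Suppose that some edge of $\mathcal T$ is a loop, that is, its two end points are the same vertex of $\mathcal T$. If $\mathcal R(\mathcal T)\neq\{0\}$, then $\pi_1(M)\neq\{1\}$. Moreover, $\mathcal R(\mathcal T)\ne\{0\}$ if and only if Thurston's equation on $\mathcal T$ is solvable in some nonzero commutative ring with identity; so, equivalently, if Thurston's equation on $\mathcal T$ is solvable in some nonzero commutative ring with identity, then $M$ is not simply connected. -/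

import Mathlib

universe u v w

/-- A (closed, oriented, generalized) triangulation with set of tetrahedra `ι`: every tetrahedron
is a copy of the standard oriented 3-simplex with vertices `0, 1, 2, 3`, and the codimension-1
faces of the disjoint union of the tetrahedra are identified in pairs by orientation reversing
affine homeomorphisms. Face `i` is the face opposite to vertex `i`. Face `i` of the tetrahedron `t`
is glued to face `perm t i i` of the tetrahedron `adj t i` by the affine map sending the vertex `j`
to the vertex `perm t i j` for `j ≠ i`. For coherently oriented tetrahedra this gluing reverses
the orientation of the face iff the permutation `perm t i` of the four vertices is odd.
Two faces of the same tetrahedron may be glued to each other; a face is not glued to itself. -/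
structure FaceGluing (ι : Type u) where
  adj : ι → Fin 4 → ι
  perm : ι → Fin 4 → Equiv.Perm (Fin 4)
  adj_adj : ∀ t i, adj (adj t i) (perm t i i) = t
  perm_adj : ∀ t i, perm (adj t i) (perm t i i) = (perm t i)⁻¹
  ne_self : ∀ t i, (adj t i, perm t i i) ≠ (t, i)
  sign_perm : ∀ t i, Equiv.Perm.sign (perm t i) = -1

namespace FaceGluing

variable {ι : Type u} (T : FaceGluing ι)

/-- The elementary identifications of points of the disjoint union of the tetrahedra: the point `x`
(in barycentric coordinates) of face `i` of `t` is identified with its image under the gluing. -/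
def PointRel (a b : Σ _ : ι, stdSimplex ℝ (Fin 4)) : Prop :=
  ∃ i : Fin 4, a.2 i = 0 ∧ b.1 = T.adj a.1 i ∧ ∀ j, b.2 (T.perm a.1 i j) = a.2 j

/-- The underlying space of the triangulation, the quotient of the disjoint union of the
tetrahedra by the identifications of the faces, with the quotient topology. -/
def Realization : Type u := Quot T.PointRel

instance : TopologicalSpace T.Realization :=
  inferInstanceAs (TopologicalSpace (Quot T.PointRel))

/-- The elementary identifications of vertices of tetrahedra. -/
def VertexRel (a b : ι × Fin 4) : Prop :=
  ∃ k, k ≠ a.2 ∧ b.1 = T.adj a.1 k ∧ b.2 = T.perm a.1 k a.2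

/-- The vertices of the triangulation: classes of identified vertices of tetrahedra. -/
def Vertex : Type u := Quot T.VertexRel

/-- The edges of the (unglued) tetrahedra, an edge being a two-element set of vertices. -/
abbrev TetEdge (ι : Type u) : Type u := ι × {s : Finset (Fin 4) // s.card = 2}

/-- The elementary identifications of edges of tetrahedra: an edge of `t` lying in face `k` is
identified with its image under the gluing of that face. -/
def EdgeRel (a b : TetEdge ι) : Prop :=
  ∃ k, k ∉ a.2.1 ∧ b.1 = T.adj a.1 k ∧ b.2.1 = a.2.1.map (T.perm a.1 k).toEmbedding

/-- The edges of the triangulation: classes of identified edges of tetrahedra. -/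
def Edge : Type u := Quot T.EdgeRel

/-- The edge of the triangulation given by an edge of a tetrahedron. -/
def edgeMk (a : TetEdge ι) : T.Edge := Quot.mk _ a

/-- The vertex of the triangulation given by a vertex of a tetrahedron. -/
def vertexMk (a : ι × Fin 4) : T.Vertex := Quot.mk _ a

/-- An edge is a loop if its two end points are the same vertex of the triangulation. -/
def IsLoop (e : T.Edge) : Prop :=
  ∃ (t : ι) (i j : Fin 4) (h : i ≠ j),
    T.edgeMk (t, ⟨{i, j}, Finset.card_pair h⟩) = e ∧ T.vertexMk (t, i) = T.vertexMk (t, j)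

/-- The three quads of a tetrahedron correspond to its three pairs of opposite edges. The quad
`q : Fin 3` corresponds to (and faces) the edges `{0, q + 1}` and its opposite; so the quads
`0, 1, 2` face the edges `{0, 1}, {2, 3}`, resp. `{0, 2}, {1, 3}`, resp. `{0, 3}, {1, 2}`.
The orientation of the tetrahedron gives the cyclic order `q → q'` of the quads, which is
`0 → 1 → 2 → 0`, that is `q' = q + 1` in `Fin 3`: at each vertex it is the cyclic order of the
three edges at this vertex as seen from the vertex (at vertex `0` these are `01, 02, 03`,
at vertex `1` they are `10, 13, 12`, and so on), so it is preserved by even permutations of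
the vertices. The function below is the quad facing a given edge. -/
def quadFacing (s : Finset (Fin 4)) : Fin 3 :=
  if (0 ∈ s ↔ 1 ∈ s) then 0 else if (0 ∈ s ↔ 2 ∈ s) then 1 else 2

section Equation

variable [Fintype ι] {R : Type v} [CommRing R]

open Classical in
/-- The holonomy `∏_{q ∼ e} x q` of an edge `e`, for an assignment `x` of ring elements to the
quads: the product, over all edges of tetrahedra that belong to the class `e`, of the value at the
quad facing this edge. (Both edges facing a quad may belong to `e`; then the quad counts twice.) -/
noncomputable def holonomy (x : ι → Fin 3 → R) (e : T.Edge) : R :=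
  ∏ a : TetEdge ι with T.edgeMk a = e, x a.1 (quadFacing a.2.1)

/-- Solutions of Thurston's equation in a commutative ring. All edges are interior, as all faces
are glued. -/
def IsThurstonSolution (x : ι → Fin 3 → R) : Prop :=
  (∀ t q, x t (q + 1) * (1 - x t q) = 1) ∧ ∀ e : T.Edge, T.holonomy x e = 1

end Equation

/-- Thurston's equation is solvable in the commutative ring `R`. -/
def ThurstonSolvable [Fintype ι] (R : Type v) [CommRing R] : Prop :=
  ∃ x : ι → Fin 3 → R, T.IsThurstonSolution x

/-- The ideal of relations `q' (1 - q) - 1`, for `q → q'`, in the polynomial ring over `ℤ` in the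
three quads of a tetrahedron. -/
noncomputable def tetIdeal : Ideal (MvPolynomial (Fin 3) ℤ) :=
  Ideal.span (Set.range fun q : Fin 3 =>
    (MvPolynomial.X (q + 1) * (1 - MvPolynomial.X q) - 1 : MvPolynomial (Fin 3) ℤ))

/-- The Thurston ring of a single tetrahedron: the polynomial ring over `ℤ` in the three quads
modulo the relations `q' (1 - q) = 1` for `q → q'`. -/
def TetRing : Type := MvPolynomial (Fin 3) ℤ ⧸ tetIdeal

noncomputable instance : CommRing TetRing :=
  inferInstanceAs (CommRing (MvPolynomial (Fin 3) ℤ ⧸ tetIdeal))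

/-- The quotient map from the polynomial ring to the Thurston ring of a tetrahedron. -/
noncomputable def TetRing.mk : MvPolynomial (Fin 3) ℤ →+* TetRing := Ideal.Quotient.mk tetIdeal

/-- The tensor product over `ℤ`, over all tetrahedra, of the Thurston rings of the tetrahedra. -/
abbrev TetRingTensor (ι : Type u) : Type u := PiTensorProduct ℤ fun _ : ι => TetRing

open Classical in
/-- The element of the tensor product given by the quad `q` of the tetrahedron `t`, that is, the
pure tensor with this quad as its factor at `t` and `1` as its other factors. -/
noncomputable def quadElement (t : ι) (q : Fin 3) : TetRingTensor ι :=
  PiTensorProduct.singleAlgHom (R := ℤ) (A := fun _ : ι => TetRing) t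
    (TetRing.mk (MvPolynomial.X q))

/-- The Thurston ring of the triangulation: the quotient of the tensor product of the Thurston
rings of the tetrahedra by the ideal generated by `W_e - 1` for all edges `e`. -/
abbrev ThurstonRing [Fintype ι] : Type u :=
  TetRingTensor ι ⧸ Ideal.span (Set.range fun e : T.Edge => T.holonomy quadElement e - 1)

end FaceGluing

/-! A nonzero ring maps onto a field `K`, and solutions push forward, so let the solution `x` take
values in `K`. Model the tetrahedron `t` by the points `∞, 0, 1, x t 0` of the projective line.
These are distinct, because the relations force `x t 0 ≠ 0, 1`. Across each face there is exactly
one Möbius transformation `c t i` that carries the model of the neighbour to that of `t` on the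
three shared vertices. The equation at an edge says that the composite of the `c t i` around that
edge is trivial.

Hence `c` is the transition cocycle of a torsor with discrete group which has local sections away
from the vertices of the triangulation. A vertex of a 3-manifold has punctured ball neighbourhoods,
which are simply connected, so the torsor is trivial there too and extends over the vertex. If `M`
is simply connected, the torsor is trivial and `c` is a coboundary: `s (adj t i) = s t * c t i`
(`exists_potential`). Moving the model of `t` by `s t` gives a developing map that is well defined
on vertices of the triangulation and injective on the four vertices of each tetrahedron. So no edge
is a loop (`not_isLoop_of_isThurstonSolution`).

Three inputs carry this: the gluing of local sections, the combinatorics of rotating about an edge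
(`exists_edge_potential`), and the cross ratios of the model simplex (`exists_frame_modelPoint`).
The statement on the Thurston ring holds because that ring carries the universal solution. -/

/-! ### Topological inputs: covering spaces, complements of rays and lines. -/

/-- A Čech 1-cocycle with values in a discrete group is a coboundary over a simply connected,
locally path connected space. -/
theorem exists_trivialization_of_simplyConnectedSpace {B J G : Type*} [TopologicalSpace B]
    [SimplyConnectedSpace B] [LocallyPathConnectedSpace B] [Group G] [TopologicalSpace G]
    [DiscreteTopology G] (V : J → Set B) (hV : ∀ j, IsOpen (V j)) (hcov : ∀ b, ∃ j, b ∈ V j)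
    (γ : J → J → B → G) (hγ : ∀ i j, ContinuousOn (γ i j) (V i ∩ V j))
    (hself : ∀ i, ∀ b ∈ V i, γ i i b = 1)
    (hmul : ∀ i j k, ∀ b ∈ V i ∩ V j ∩ V k, γ i j b * γ j k b = γ i k b) :
    ∃ β : J → B → G, (∀ j, ContinuousOn (β j) (V j)) ∧
      ∀ i j, ∀ b ∈ V i ∩ V j, β i b * γ i j b = β j b := by
  choose idx hidx using hcov
  -- The bundle with discrete fibre `G` and transitions `g ↦ g * γ i j b` is a covering of `B`.
  -- Simple connectedness lifts the identity to a section, and `β j` is that section read in the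
  -- chart `j`.
  let Z : FiberBundleCore J B G :=
    { baseSet := V
      isOpen_baseSet := hV
      indexAt := idx
      mem_baseSet_at := hidx
      coordChange := fun i j b g => g * γ i j b
      coordChange_self := fun i b hb g => by simp [hself i b hb]
      continuousOn_coordChange := fun i j => by
        refine continuousOn_snd.mul ((hγ i j).comp continuousOn_fst ?_)
        intro p hp
        exact hp.1
      coordChange_comp := fun i j k b hb g => by
        rw [mul_assoc, hmul i j k b hb] }
  have hcovering : IsCoveringMap (Bundle.TotalSpace.proj : Z.TotalSpace → B) :=
    FiberBundle.isCoveringMap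
  obtain ⟨b₀⟩ := (inferInstance : Nonempty B)
  obtain ⟨σ, ⟨-, hσ⟩, -⟩ := hcovering.existsUnique_continuousMap_lifts (ContinuousMap.id B) b₀
    (⟨b₀, (1 : G)⟩ : Z.TotalSpace) rfl
  have hproj : ∀ b, (σ b).proj = b := fun b => congrFun hσ b
  refine ⟨fun j b => (Z.localTriv j (σ b)).2, fun j => ?_, fun i j b hb => ?_⟩
  · refine continuous_snd.comp_continuousOn
      ((Z.localTriv j).continuousOn.comp σ.continuous.continuousOn fun b hb => ?_)
    rw [Z.mem_localTriv_source, hproj]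
    exact hb
  · simp only [FiberBundleCore.localTriv_apply, hproj]
    have key : ∀ g : G, g * γ (idx b) i b * γ i j b = g * γ (idx b) j b := fun g => by
      rw [mul_assoc, hmul _ _ _ b ⟨⟨hidx b, hb.1⟩, hb.2⟩]
    exact key _

/-- The complement of a ray in a real vector space is contractible. -/
theorem contractibleSpace_compl_ray {E : Type*} [AddCommGroup E] [Module ℝ E] [TopologicalSpace E]
    [ContinuousAdd E] [ContinuousSMul ℝ E] {z : E} (hz : z ≠ 0) :
    ContractibleSpace ({x : E | ∃ r : ℝ, 0 ≤ r ∧ x = r • z}ᶜ : Set E) := by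
  have hmem : -z ∈ ({x : E | ∃ r : ℝ, 0 ≤ r ∧ x = r • z}ᶜ : Set E) := by
    rintro ⟨r, hr, h⟩
    have h' : (r + 1) • z = 0 := by rw [add_smul, ← h]; simp
    rcases smul_eq_zero.1 h' with h0 | h0
    · linarith
    · exact hz h0
  -- Star-shaped about `-z`: if `a • (-z) + b • y = r • z` with `b > 0`, then `y = (b⁻¹ * (r + a)) •
  -- z` lies on the ray already.
  refine StarConvex.contractibleSpace (x := -z) ?_ ⟨_, hmem⟩
  rintro y hy a b ha hb hab ⟨r, hr, h⟩
  rcases hb.eq_or_lt with rfl | hb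
  · obtain rfl : a = 1 := by linarith
    exact hmem ⟨r, hr, by simpa using h⟩
  · refine hy ⟨b⁻¹ * (r + a), by positivity, ?_⟩
    have h2 : b • y = (r + a) • z := by
      rw [add_smul, ← h]; simp
    rw [mul_smul, ← h2, smul_smul, inv_mul_cancel₀ hb.ne', one_smul]

/-- The complement of a line in a real vector space of dimension at least 3 is connected. -/
theorem isConnected_compl_line {E : Type*} [NormedAddCommGroup E] [NormedSpace ℝ E]
    (hE : 3 ≤ Module.finrank ℝ E) (z : E) :
    IsConnected ({x : E | ∃ r : ℝ, x = r • z}ᶜ : Set E) := by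
  have : Module.Finite ℝ E := Module.finite_of_finrank_pos (by omega)
  have h := isConnected_compl_of_one_lt_codim (F := E) (E := Submodule.span ℝ {z}) (by
    rw [← Module.finrank_eq_rank]
    have h1 := Submodule.finrank_quotient_add_finrank (Submodule.span ℝ {z})
    have h2 := finrank_span_le_card (R := ℝ) ({z} : Set E)
    simp only [Set.toFinset_singleton, Finset.card_singleton] at h2
    have : 1 < Module.finrank ℝ (E ⧸ Submodule.span ℝ {z}) := by omega
    exact_mod_cast this)
  convert! h using 3
  ext x
  simp [Submodule.mem_span_singleton, eq_comm]

/-! ### Sections of the torsor with transitions `c`, and how they glue. -/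

section

open Set Topology Filter

namespace FaceGluing

variable {ι : Type u} (T : FaceGluing ι)

/-- The quotient map from the disjoint union of the tetrahedra to the underlying space. -/
def toRealization (a : Σ _ : ι, stdSimplex ℝ (Fin 4)) : T.Realization := Quot.mk _ a

theorem isQuotientMap_toRealization : IsQuotientMap T.toRealization := isQuotientMap_quot_mk

theorem toRealization_surjective : Function.Surjective T.toRealization :=
  T.isQuotientMap_toRealization.surjective

variable {T} {G : Type*} [Group G] [TopologicalSpace G] {c : ι → Fin 4 → G}

variable (T) in
/-- Over the subset `U` of the underlying space, `s` is a section of the `G`-torsor that is trivial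
over each tetrahedron and has `c` as the transition along the faces. -/
structure IsSection (c : ι → Fin 4 → G) (U : Set T.Realization)
    (s : (Σ _ : ι, stdSimplex ℝ (Fin 4)) → G) : Prop where
  continuousOn : ContinuousOn s (T.toRealization ⁻¹' U)
  map_glue : ∀ a b i, T.toRealization a ∈ U → a.2 i = 0 → b.1 = T.adj a.1 i →
    (∀ j, b.2 (T.perm a.1 i j) = a.2 j) → s b = s a * c a.1 i

theorem IsSection.mono {U V : Set T.Realization} {s} (h : T.IsSection c U s) (hVU : V ⊆ U) :
    T.IsSection c V s :=
  ⟨h.continuousOn.mono (preimage_mono hVU), fun a b i ha => h.map_glue a b i (hVU ha)⟩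

theorem toRealization_eq_of_glue {a b : Σ _ : ι, stdSimplex ℝ (Fin 4)} {i : Fin 4} (h0 : a.2 i = 0)
    (h1 : b.1 = T.adj a.1 i) (h2 : ∀ j, b.2 (T.perm a.1 i j) = a.2 j) :
    T.toRealization a = T.toRealization b :=
  Quot.sound ⟨i, h0, h1, h2⟩

variable [DiscreteTopology G]

/-- Two sections differ by a locally constant function on the underlying space. -/
theorem IsSection.exists_ratio {U V : Set T.Realization} (hU : IsOpen U) (hV : IsOpen V)
    {s s' : (Σ _ : ι, stdSimplex ℝ (Fin 4)) → G} (hs : T.IsSection c U s)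
    (hs' : T.IsSection c V s') :
    ∃ d : T.Realization → G, ContinuousOn d (U ∩ V) ∧
      ∀ a, T.toRealization a ∈ U ∩ V → d (T.toRealization a) = s a * (s' a)⁻¹ := by
  classical
  -- Transitions multiply on the right, so they cancel in `s * s'⁻¹`, which therefore descends to
  -- the quotient.
  let F : (Σ _ : ι, stdSimplex ℝ (Fin 4)) → G :=
    fun a => if T.toRealization a ∈ U ∩ V then s a * (s' a)⁻¹ else 1
  have hF : ∀ a b, T.PointRel a b → F a = F b := by
    rintro a b ⟨i, h0, h1, h2⟩
    have hab := toRealization_eq_of_glue h0 h1 h2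
    simp only [F, ← hab]
    split_ifs with h
    · rw [hs.map_glue a b i h.1 h0 h1 h2, hs'.map_glue a b i h.2 h0 h1 h2]
      group
    · rfl
  obtain ⟨d, hdF⟩ : ∃ d : T.Realization → G, ∀ a, d (T.toRealization a) = F a :=
    ⟨Quot.lift F hF, fun a => rfl⟩
  have key : ∀ a, T.toRealization a ∈ U ∩ V →
      d (T.toRealization a) = s a * (s' a)⁻¹ := fun a ha => (hdF a).trans (if_pos ha)
  refine ⟨d, ?_, key⟩
  rw [T.isQuotientMap_toRealization.continuousOn_isOpen_iff (hU.inter hV)]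
  refine ContinuousOn.congr (f := fun a => s a * (s' a)⁻¹) ?_ key
  exact (hs.continuousOn.mono fun a ha => ha.1).mul (hs'.continuousOn.mono fun a ha => ha.2).inv

/-- Local sections give a section over a simply connected open subset. -/
theorem exists_isSection_range {B : Type*} [TopologicalSpace B] [SimplyConnectedSpace B]
    [LocallyPathConnectedSpace B] {f : B → T.Realization} (hf : IsOpenEmbedding f)
    (hloc : ∀ b, ∃ V s, IsOpen V ∧ f b ∈ V ∧ T.IsSection c V s) :
    ∃ s, T.IsSection c (range f) s := by
  choose V s hVo hbV hs using hloc
  choose d hd hds using fun i j => (hs i).exists_ratio (hVo i) (hVo j) (hs j)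
  obtain ⟨β, hβ, hβd⟩ := exists_trivialization_of_simplyConnectedSpace (fun j => f ⁻¹' V j)
    (fun j => (hVo j).preimage hf.continuous) (fun b => ⟨b, hbV b⟩) (fun i j b => d i j (f b))
    (fun i j => (hd i j).comp hf.continuous.continuousOn fun b hb => hb)
    (fun i b hb => by
      obtain ⟨a, ha⟩ := T.toRealization_surjective (f b)
      rw [← ha, hds i i a (by rw [ha]; exact ⟨hb, hb⟩), mul_inv_cancel])
    (fun i j k b hb => by
      obtain ⟨a, ha⟩ := T.toRealization_surjective (f b)
      rw [← ha, hds i j a (by rw [ha]; exact hb.1), hds j k a (by rw [ha]; exact ⟨hb.1.2, hb.2⟩),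
        hds i k a (by rw [ha]; exact ⟨hb.1.1, hb.2⟩)]
      group)
  have hne : Nonempty B := inferInstance
  let e := hf.toOpenPartialHomeomorph f
  have hel : ∀ b, e.symm (f b) = b := fun b => hf.toOpenPartialHomeomorph_left_inv f
  -- Since `β i * d i j = β j` and `d i j = s i * (s j)⁻¹`, the corrected sections `β j * s j` agree
  -- on overlaps. Over the point `f b` the index `b` itself is used.
  let S : (Σ _ : ι, stdSimplex ℝ (Fin 4)) → G := fun a =>
    β (e.symm (T.toRealization a)) (e.symm (T.toRealization a)) *
      s (e.symm (T.toRealization a)) a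
  have hS : ∀ j b a, f b = T.toRealization a → f b ∈ V j →
      S a = β j (e.symm (T.toRealization a)) * s j a := by
    intro j b a hab hb
    simp only [S, ← hab, hel]
    rw [← hβd b j b ⟨hbV b, hb⟩, hab, hds b j a (by rw [← hab]; exact ⟨hbV b, hb⟩)]
    group
  refine ⟨S, ?_, ?_⟩
  · rintro a ⟨b, hab⟩
    have hcont : ContinuousOn (fun a => β b (e.symm (T.toRealization a)) * s b a)
        (T.toRealization ⁻¹' (f '' (f ⁻¹' V b))) := by
      refine ContinuousOn.mul ?_ ?_
      · refine (hβ b).comp ?_ ?_ (t := f ⁻¹' V b)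
        · refine ContinuousOn.comp (t := range f) ?_
            T.isQuotientMap_toRealization.continuous.continuousOn ?_
          · have := e.symm.continuousOn
            simpa [e] using this
          · rintro a' ⟨b', -, h⟩
            exact ⟨b', h⟩
        · rintro a' ⟨b', hb', h⟩
          simp only [← h, hel]
          exact hb'
      · refine (hs b).continuousOn.mono ?_
        rintro a' ⟨b', hb', h⟩
        rw [mem_preimage, ← h]
        exact hb'
    have hopen : IsOpen (T.toRealization ⁻¹' (f '' (f ⁻¹' V b))) :=
      (hf.isOpenMap _ ((hVo b).preimage hf.continuous)).preimage
        T.isQuotientMap_toRealization.continuous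
    have hmem : a ∈ T.toRealization ⁻¹' (f '' (f ⁻¹' V b)) := ⟨b, hbV b, hab⟩
    refine ContinuousAt.continuousWithinAt ?_
    refine (hcont.continuousAt (hopen.mem_nhds hmem)).congr ?_
    filter_upwards [hopen.mem_nhds hmem] with a' ha'
    obtain ⟨b', hb', h⟩ := ha'
    exact (hS b b' a' h hb').symm
  · rintro a a' i ⟨b, hab⟩ h0 h1 h2
    have haa := toRealization_eq_of_glue h0 h1 h2
    rw [hS b b a hab (hbV b), hS b b a' (hab.trans haa) (hbV b), ← haa,
      (hs b).map_glue a a' i (by rw [← hab]; exact hbV b) h0 h1 h2]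
    group

/-- Sections over two open sets with connected intersection can be glued. -/
theorem IsSection.exists_union {U V : Set T.Realization} (hU : IsOpen U) (hV : IsOpen V)
    (hUV : IsPreconnected (U ∩ V)) {s s' : (Σ _ : ι, stdSimplex ℝ (Fin 4)) → G}
    (hs : T.IsSection c U s) (hs' : T.IsSection c V s') : ∃ s'', T.IsSection c (U ∪ V) s'' := by
  classical
  obtain ⟨d, hd, hds⟩ := hs.exists_ratio hU hV hs'
  obtain ⟨g, hg⟩ : ∃ g : G, ∀ x ∈ U ∩ V, d x = g := by
    rcases (U ∩ V).eq_empty_or_nonempty with h | ⟨x, hx⟩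
    · exact ⟨1, by simp [h]⟩
    · exact ⟨d x, fun y hy => hUV.constant hd hy hx⟩
  -- The ratio is a constant `g` on the connected overlap, and left multiplication by `g` makes `s'`
  -- match `s` there.
  let S : (Σ _ : ι, stdSimplex ℝ (Fin 4)) → G := fun a =>
    if T.toRealization a ∈ U then s a else g * s' a
  have hSU : ∀ a, T.toRealization a ∈ U → S a = s a := fun a ha => if_pos ha
  have hSV : ∀ a, T.toRealization a ∈ V → S a = g * s' a := fun a ha => by
    by_cases h : T.toRealization a ∈ U
    · rw [hSU a h, ← hg _ ⟨h, ha⟩, hds a ⟨h, ha⟩]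
      group
    · exact if_neg h
  have hc := T.isQuotientMap_toRealization.continuous
  refine ⟨S, ?_, ?_⟩
  · rw [preimage_union]
    refine ContinuousOn.union_of_isOpen (hs.continuousOn.congr hSU) ?_ (hU.preimage hc)
      (hV.preimage hc)
    exact (continuousOn_const.mul hs'.continuousOn).congr hSV
  · rintro a b i ha h0 h1 h2
    have hab := toRealization_eq_of_glue h0 h1 h2
    rcases ha with ha | ha
    · rw [hSU a ha, hSU b (hab ▸ ha), hs.map_glue a b i ha h0 h1 h2]
    · rw [hSV a ha, hSV b (hab ▸ ha), hs'.map_glue a b i ha h0 h1 h2, mul_assoc]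

/-- Local sections give a section over a punctured ball of dimension at least three. -/
theorem exists_isSection_image_compl {E : Type*} [NormedAddCommGroup E] [NormedSpace ℝ E]
    (hE : 3 ≤ Module.finrank ℝ E) {f : E → T.Realization} (hf : IsOpenEmbedding f)
    (hloc : ∀ b, b ≠ 0 → ∃ V s, IsOpen V ∧ f b ∈ V ∧ T.IsSection c V s) :
    ∃ s, T.IsSection c (f '' {0}ᶜ) s := by
  have : Module.Finite ℝ E := Module.finite_of_finrank_pos (by omega)
  have : Nontrivial E := Module.nontrivial_of_finrank_pos (R := ℝ) (by omega)
  obtain ⟨z, hz⟩ := exists_ne (0 : E)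
  -- The complements of two opposite rays are contractible and cover the punctured space. They meet
  -- in the complement of a line, which is connected because the dimension is at least three.
  let A : E → Set E := fun z => {x : E | ∃ r : ℝ, 0 ≤ r ∧ x = r • z}ᶜ
  have hclosed : ∀ z : E, IsClosed {x : E | ∃ r : ℝ, 0 ≤ r ∧ x = r • z} := by
    intro z
    rcases eq_or_ne z 0 with rfl | hz
    · convert isClosed_singleton (x := (0 : E)) using 1
      ext x
      simp only [smul_zero, mem_ofPred_eq, mem_singleton_iff]
      exact ⟨fun ⟨r, _, h⟩ => h, fun h => ⟨0, le_rfl, h⟩⟩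
    · have := (isClosedEmbedding_smul_left (𝕜 := ℝ) hz).isClosedMap _ (isClosed_Ici (a := (0 : ℝ)))
      convert this using 1
      ext x
      simp [eq_comm]
  have hA : ∀ z : E, z ≠ 0 → ∃ s, T.IsSection c (f '' A z) s := by
    intro z hz
    have hopen : IsOpen (A z) := (hclosed z).isOpen_compl
    have : LocallyPathConnectedSpace (A z) := hopen.locallyPathConnectedSpace
    have : ContractibleSpace (A z) := contractibleSpace_compl_ray hz
    have hemb : IsOpenEmbedding (fun x : A z => f x) := hf.comp hopen.isOpenEmbedding_subtypeVal
    obtain ⟨s, hs⟩ := exists_isSection_range hemb (c := c) fun b => hloc b fun h0 => b.2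
      ⟨0, le_rfl, by simpa using h0⟩
    refine ⟨s, ?_⟩
    convert hs using 1
    ext x
    simp
  obtain ⟨s, hs⟩ := hA z hz
  obtain ⟨s', hs'⟩ := hA (-z) (neg_ne_zero.2 hz)
  have hopen : ∀ z, IsOpen (f '' A z) := fun z => hf.isOpenMap _ (hclosed z).isOpen_compl
  have hline : A z ∩ A (-z) = {x : E | ∃ r : ℝ, x = r • z}ᶜ := by
    rw [← compl_union]
    congr 1
    ext x
    constructor
    · rintro (⟨r, -, h⟩ | ⟨r, -, h⟩)
      · exact ⟨r, h⟩
      · exact ⟨-r, by simp [h]⟩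
    · rintro ⟨r, h⟩
      rcases le_total 0 r with hr | hr
      · exact Or.inl ⟨r, hr, h⟩
      · exact Or.inr ⟨-r, by linarith, by simp [h]⟩
  have hconn : IsPreconnected (f '' A z ∩ f '' A (-z)) := by
    rw [← image_inter hf.injective, hline]
    exact (isConnected_compl_line hE z).isPreconnected.image f hf.continuous.continuousOn
  obtain ⟨s'', hs''⟩ := hs.exists_union (hopen _) (hopen _) hconn hs'
  refine ⟨s'', hs''.mono ?_⟩
  rw [← image_union]
  refine image_mono fun x hx => ?_
  by_contra h
  rw [mem_union, not_or] at h
  simp only [A, mem_compl_iff, not_not] at h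
  obtain ⟨⟨r, hr, h1⟩, ⟨r', hr', h2⟩⟩ := h
  have h3 : (r + r') • z = 0 := by
    rw [add_smul, ← h1, h2]; simp
  rcases smul_eq_zero.1 h3 with h4 | h4
  · have : r = 0 := by linarith
    exact hx (by simp [h1, this])
  · exact hz h4

end FaceGluing

end

/-! ### Charts, and local sections over barycentric stars. -/

section

open Set Topology Filter

/-- Every point of a manifold modelled on a normed space has arbitrarily small neighbourhoods
homeomorphic to the model space. -/
theorem ChartedSpace.exists_isOpenEmbedding {E M : Type*} [NormedAddCommGroup E] [NormedSpace ℝ E]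
    [TopologicalSpace M] [ChartedSpace E M] (p : M) {O : Set M} (hO : O ∈ 𝓝 p) :
    ∃ f : E → M, IsOpenEmbedding f ∧ f 0 = p ∧ range f ⊆ O := by
  let e := chartAt E p
  have hp : p ∈ e.source := mem_chart_source E p
  have h1 : e.target ∩ e.symm ⁻¹' O ∈ 𝓝 (e p) := by
    refine inter_mem (e.open_target.mem_nhds (e.map_source hp)) ?_
    refine (e.symm.continuousAt (e.map_source hp)).preimage_mem_nhds ?_
    rwa [e.left_inv hp]
  obtain ⟨r, hr, hball⟩ := Metric.mem_nhds_iff.1 h1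
  have hmem : ∀ x, OpenPartialHomeomorph.univBall (e p) r x ∈ Metric.ball (e p) r := fun x => by
    rw [← OpenPartialHomeomorph.univBall_target (e p) hr]
    exact (OpenPartialHomeomorph.univBall (e p) r).map_source (by simp)
  -- All of `E` is shrunk homeomorphically onto a small ball in the chart, and the inverse chart
  -- carries this ball into `O`.
  let k := (OpenPartialHomeomorph.univBall (e p) r).trans e.symm
  have hk : k.source = univ := by
    ext x
    simp only [k, OpenPartialHomeomorph.trans_source, OpenPartialHomeomorph.univBall_source,
      univ_inter, mem_preimage, mem_univ, iff_true]
    exact (hball (hmem x)).1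
  refine ⟨k, k.isOpenEmbedding hk, ?_, ?_⟩
  · simp [k, e.left_inv hp]
  · rintro _ ⟨x, rfl⟩
    exact (hball (hmem x)).2

namespace FaceGluing

variable {ι : Type u} {T : FaceGluing ι}

/-- The coordinates of `y` with index in `A` are positive, and larger than all other coordinates. -/
def IsDominant (y : stdSimplex ℝ (Fin 4)) (A : Finset (Fin 4)) : Prop :=
  (∀ i ∈ A, 0 < y i) ∧ ∀ i ∈ A, ∀ j ∉ A, y j < y i

/-- Otherwise some `i ∈ A \ B` and `j ∈ B \ A` would satisfy both `y j < y i` and `y i < y j`. Thus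
the stars of distinct faces with the same number of vertices are disjoint within a tetrahedron. -/
theorem IsDominant.eq_of_card_eq {y : stdSimplex ℝ (Fin 4)} {A B : Finset (Fin 4)}
    (hA : IsDominant y A) (hB : IsDominant y B) (h : A.card = B.card) : A = B := by
  by_cases hAB : A ⊆ B
  · exact Finset.eq_of_subset_of_card_le hAB h.ge
  by_cases hBA : B ⊆ A
  · exact (Finset.eq_of_subset_of_card_le hBA h.le).symm
  obtain ⟨i, hi, hi'⟩ := Finset.not_subset.1 hAB
  obtain ⟨j, hj, hj'⟩ := Finset.not_subset.1 hBA
  exact absurd (hA.2 i hi j hj') (hB.2 j hj i hi').not_gt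

theorem isOpen_isDominant (A : Finset (Fin 4)) : IsOpen {y | IsDominant y A} := by
  have hc : ∀ i : Fin 4, Continuous fun y : stdSimplex ℝ (Fin 4) => y i := fun i =>
    (continuous_apply i).comp continuous_subtype_val
  have : {y | IsDominant y A} = (⋂ i ∈ A, {y : stdSimplex ℝ (Fin 4) | 0 < y i}) ∩
      ⋂ i ∈ A, ⋂ j ∈ Aᶜ, {y : stdSimplex ℝ (Fin 4) | y j < y i} := by
    ext y
    simp [IsDominant]
  rw [this]
  refine (isOpen_biInter_finset fun i _ => isOpen_lt continuous_const (hc i)).inter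
    (isOpen_biInter_finset fun i _ => isOpen_biInter_finset fun j _ => isOpen_lt (hc j) (hc i))

theorem IsDominant.notMem {y : stdSimplex ℝ (Fin 4)} {A : Finset (Fin 4)} (h : IsDominant y A)
    {k : Fin 4} (hk : y k = 0) : k ∉ A := fun hA => (h.1 k hA).ne' hk

theorem IsDominant.map {y y' : stdSimplex ℝ (Fin 4)} {A : Finset (Fin 4)} (h : IsDominant y A)
    {σ : Equiv.Perm (Fin 4)} (hσ : ∀ j, y' (σ j) = y j) :
    IsDominant y' (A.map σ.toEmbedding) := by
  constructor
  · intro i hi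
    obtain ⟨i, hiA, rfl⟩ := Finset.mem_map.1 hi
    simpa [hσ] using h.1 i hiA
  · intro i hi j hj
    obtain ⟨i, hiA, rfl⟩ := Finset.mem_map.1 hi
    obtain ⟨j, rfl⟩ := σ.surjective j
    simp only [Equiv.coe_toEmbedding, hσ]
    exact h.2 i hiA j fun hj' => hj (Finset.mem_map_of_mem _ hj')

/-- The nonzero coordinates dominate the zero ones, so every point lies in the star of the smallest
face containing it. -/
theorem exists_isDominant_support (y : stdSimplex ℝ (Fin 4)) :
    ∃ A : Finset (Fin 4), A.Nonempty ∧ IsDominant y A ∧ ∀ i, i ∈ A ↔ y i ≠ 0 := by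
  have hA : ∀ i, i ∈ (Finset.univ.filter fun i => y i ≠ 0) ↔ y i ≠ 0 := by simp
  refine ⟨Finset.univ.filter fun i => y i ≠ 0, ?_, ⟨fun i hi => ?_, fun i hi j hj => ?_⟩, hA⟩
  · by_contra h
    rw [Finset.not_nonempty_iff_eq_empty] at h
    have h0 : ∀ i, y i = 0 := fun i => by
      by_contra hi
      simpa [h] using (hA i).2 hi
    have h1 := y.2.2
    have h2 : ∑ i, y i = 0 := Finset.sum_eq_zero fun i _ => h0 i
    exact zero_ne_one (h2.symm.trans h1)
  · exact lt_of_le_of_ne (y.2.1 i) (Ne.symm ((hA i).1 hi))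
  · have hj0 : y j = 0 := by
      by_contra h
      exact hj ((hA j).2 h)
    rw [hj0]
    exact lt_of_le_of_ne (y.2.1 i) (Ne.symm ((hA i).1 hi))

theorem pointRel_symm {a b : Σ _ : ι, stdSimplex ℝ (Fin 4)} (h : T.PointRel a b) :
    T.PointRel b a := by
  obtain ⟨t, y⟩ := a
  obtain ⟨t', y'⟩ := b
  obtain ⟨i, h0, h1, h2⟩ := h
  dsimp only at h0 h1 h2
  subst h1
  refine ⟨T.perm t i i, (h2 i).trans h0, (T.adj_adj t i).symm, fun j => ?_⟩
  obtain ⟨j, rfl⟩ := (T.perm t i).surjective j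
  simp [T.perm_adj, h2]

/-- A property of points that is preserved by the elementary identifications holds for all points
representing the same point of the underlying space. -/
theorem of_toRealization_eq {P : (Σ _ : ι, stdSimplex ℝ (Fin 4)) → Prop}
    (hP : ∀ a b, T.PointRel a b → P a → P b) {a b} (hab : T.toRealization a = T.toRealization b)
    (ha : P a) : P b := by
  have key : ∀ a b, T.PointRel a b → P a = P b := fun a b h =>
    propext ⟨hP a b h, hP b a (pointRel_symm h)⟩
  have h : Quot.lift P key (T.toRealization a) = Quot.lift P key (T.toRealization b) := by
    rw [hab]
  exact h.mp ha

variable (T) in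
/-- The union of the open stars, in the barycentric subdivision, of the barycenters of the simplices
with `n` vertices. -/
def barycentricStar (n : ℕ) : Set T.Realization :=
  T.toRealization '' {a | ∃ A : Finset (Fin 4), A.card = n ∧ IsDominant a.2 A}

theorem toRealization_mem_barycentricStar {n : ℕ} {a : Σ _ : ι, stdSimplex ℝ (Fin 4)} :
    T.toRealization a ∈ T.barycentricStar n ↔
      ∃ A : Finset (Fin 4), A.card = n ∧ IsDominant a.2 A := by
  refine ⟨?_, fun h => ⟨a, h, rfl⟩⟩
  rintro ⟨b, hb, hab⟩
  refine of_toRealization_eq (fun a b => ?_) hab hb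
  rintro ⟨i, h0, h1, h2⟩ ⟨A, hA, h⟩
  exact ⟨_, by simpa using hA, h.map h2⟩

theorem isOpen_barycentricStar (n : ℕ) : IsOpen (T.barycentricStar n) := by
  rw [← T.isQuotientMap_toRealization.isOpen_preimage]
  have : T.toRealization ⁻¹' T.barycentricStar n =
      ⋃ A ∈ {A : Finset (Fin 4) | A.card = n}, {a | IsDominant a.2 A} := by
    ext a
    simp [toRealization_mem_barycentricStar]
  rw [this]
  refine isOpen_biUnion fun A _ => isOpen_sigma_iff.2 fun t => ?_
  exact isOpen_isDominant A

variable {G : Type*} [Group G] [TopologicalSpace G] {c : ι → Fin 4 → G}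

/-- On the star the dominant `n`-set is unique and locally constant, so `h` evaluated at it is a
section. A potential on the `n`-vertex faces is thus all that is needed locally. -/
theorem exists_isSection_barycentricStar (n : ℕ) (h : ι → Finset (Fin 4) → G)
    (hh : ∀ t A k, A.card = n → k ∉ A →
      h (T.adj t k) (A.map (T.perm t k).toEmbedding) = h t A * c t k) :
    ∃ s, T.IsSection c (T.barycentricStar n) s := by
  classical
  let s : (Σ _ : ι, stdSimplex ℝ (Fin 4)) → G := fun a =>
    if hA : ∃ A : Finset (Fin 4), A.card = n ∧ IsDominant a.2 A then h a.1 hA.choose else 1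
  have hs : ∀ a (A : Finset (Fin 4)), A.card = n → IsDominant a.2 A → s a = h a.1 A := by
    intro a A hA hd
    have hex : ∃ A : Finset (Fin 4), A.card = n ∧ IsDominant a.2 A := ⟨A, hA, hd⟩
    simp only [s]
    rw [dif_pos hex]
    congr 1
    exact hex.choose_spec.2.eq_of_card_eq hd (hex.choose_spec.1.trans hA.symm)
  refine ⟨s, ?_, ?_⟩
  · intro a ha
    obtain ⟨A, hA, hd⟩ := toRealization_mem_barycentricStar.1 ha
    refine ContinuousAt.continuousWithinAt ?_
    refine (continuousAt_const (y := h a.1 A)).congr ?_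
    have hopen : IsOpen {b : Σ _ : ι, stdSimplex ℝ (Fin 4) | b.1 = a.1 ∧ IsDominant b.2 A} := by
      refine isOpen_sigma_iff.2 fun t => ?_
      by_cases ht : t = a.1
      · simpa [preimage, ht] using isOpen_isDominant A
      · simp [preimage, ht]
    filter_upwards [hopen.mem_nhds ⟨rfl, hd⟩] with b hb
    rw [hs b A hA hb.2, hb.1]
  · rintro a b i ha h0 h1 h2
    obtain ⟨A, hA, hd⟩ := toRealization_mem_barycentricStar.1 ha
    rw [hs a A hA hd, hs b _ (by simpa using hA) (hd.map h2), h1]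
    exact hh _ _ _ hA (hd.notMem h0)

end FaceGluing

end

/-! ### Extension over the vertices, and the global potential. -/

section

open Set Topology Filter

namespace FaceGluing

/-- The vertex `i` of the standard simplex. -/
def vertexPoint (i : Fin 4) : stdSimplex ℝ (Fin 4) := ⟨Pi.single i 1, single_mem_stdSimplex ℝ i⟩

theorem vertexPoint_apply_self (i : Fin 4) : vertexPoint i i = 1 := by
  change (Pi.single i 1 : Fin 4 → ℝ) i = 1
  simp

theorem vertexPoint_apply_of_ne {i j : Fin 4} (h : j ≠ i) : vertexPoint i j = 0 := by
  change (Pi.single i 1 : Fin 4 → ℝ) j = 0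
  simp [h]

theorem eq_vertexPoint_iff {y : stdSimplex ℝ (Fin 4)} {i : Fin 4} : y = vertexPoint i ↔ y i = 1 := by
  refine ⟨fun h => h ▸ vertexPoint_apply_self i, fun h => ?_⟩
  ext j
  rcases eq_or_ne j i with rfl | hj
  · rw [h, vertexPoint_apply_self]
  · rw [vertexPoint_apply_of_ne hj]
    have h1 := stdSimplex.sum_eq_one y
    rw [← Finset.add_sum_erase _ _ (Finset.mem_univ i), h] at h1
    have h2 : ∑ x ∈ Finset.univ.erase i, y x = 0 := by linarith
    exact (Finset.sum_eq_zero_iff_of_nonneg fun x _ => stdSimplex.zero_le y x).1 h2 j (by simp [hj])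

theorem apply_le_one (y : stdSimplex ℝ (Fin 4)) (i : Fin 4) : y i ≤ 1 := by
  rw [← stdSimplex.sum_eq_one y]
  exact Finset.single_le_sum (fun j _ => stdSimplex.zero_le y j) (Finset.mem_univ i)

/-- A corner is the only point of the simplex with `y i = 1`, so deleting it amounts to intersecting
with an open half-space and the result is convex. -/
theorem isPreconnected_punctured_ball (i : Fin 4) (ε : ℝ) :
    IsPreconnected (Metric.ball (vertexPoint i) ε ∩ {vertexPoint i}ᶜ) := by
  rw [← IsInducing.subtypeVal.isPreconnected_image]
  have : Subtype.val '' (Metric.ball (vertexPoint i) ε ∩ {vertexPoint i}ᶜ) =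
      stdSimplex ℝ (Fin 4) ∩ Metric.ball (vertexPoint i).1 ε ∩ {y : Fin 4 → ℝ | y i < 1} := by
    ext y
    constructor
    · rintro ⟨y, ⟨hy, hne⟩, rfl⟩
      refine ⟨⟨y.2, hy⟩, lt_of_le_of_ne (apply_le_one y i) fun h => hne ?_⟩
      exact eq_vertexPoint_iff.2 h
    · rintro ⟨⟨hy, hb⟩, h⟩
      refine ⟨⟨y, hy⟩, ⟨hb, fun he => ?_⟩, rfl⟩
      exact h.ne (eq_vertexPoint_iff.1 he)
  rw [this]
  refine Convex.isPreconnected (((convex_stdSimplex ℝ _).inter (convex_ball _ _)).inter ?_)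
  exact convex_halfSpace_lt (LinearMap.isLinear (LinearMap.proj i)) 1

/-- The segment from the vertex `i` to the vertex `l` of the standard simplex. -/
def edgePoint {i l : Fin 4} (_h : i ≠ l) (δ : unitInterval) : stdSimplex ℝ (Fin 4) :=
  ⟨Pi.single i (1 - (δ : ℝ)) + Pi.single l (δ : ℝ), by
    constructor
    · intro j
      have h1 : 0 ≤ 1 - (δ : ℝ) := sub_nonneg.2 δ.2.2
      have h2 : 0 ≤ (δ : ℝ) := δ.2.1
      simp only [Pi.add_apply, Pi.single_apply]
      split_ifs <;> linarith
    · simp [Finset.sum_add_distrib]⟩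

theorem edgePoint_apply {i l : Fin 4} (h : i ≠ l) (δ : unitInterval) (j : Fin 4) :
    edgePoint h δ j = (if j = i then 1 - (δ : ℝ) else 0) + if j = l then (δ : ℝ) else 0 := by
  change (Pi.single i (1 - (δ : ℝ)) + Pi.single l (δ : ℝ) : Fin 4 → ℝ) j = _
  simp [Pi.single_apply]

theorem tendsto_edgePoint {i l : Fin 4} (h : i ≠ l) :
    Tendsto (edgePoint h) (𝓝[≠] 0) (𝓝[≠] (vertexPoint i)) := by
  have h0 : edgePoint h 0 = vertexPoint i := by
    rw [eq_vertexPoint_iff, edgePoint_apply]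
    simp [h]
  have hcont : Continuous (edgePoint h) := by
    refine Continuous.subtype_mk ?_ _
    refine continuous_pi fun j => ?_
    simp only [Pi.add_apply, Pi.single_apply]
    split_ifs <;> fun_prop
  refine tendsto_nhdsWithin_iff.2 ⟨?_, ?_⟩
  · rw [← h0]
    exact hcont.continuousAt.mono_left nhdsWithin_le_nhds
  · filter_upwards [self_mem_nhdsWithin] with δ hδ he
    have h1 := eq_vertexPoint_iff.1 he
    rw [edgePoint_apply] at h1
    simp only [↓reduceIte, if_neg h, add_zero] at h1
    exact hδ (Subtype.ext (by simpa using h1))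

variable {ι : Type u} {T : FaceGluing ι}

theorem exists_eq_vertexPoint {t t' : ι} {y : stdSimplex ℝ (Fin 4)} {i : Fin 4}
    (h : T.toRealization ⟨t', vertexPoint i⟩ = T.toRealization ⟨t, y⟩) :
    ∃ j, y = vertexPoint j := by
  refine of_toRealization_eq (P := fun a => ∃ j, a.2 = vertexPoint j) ?_ h ⟨i, rfl⟩
  rintro a b ⟨k, -, -, h2⟩ ⟨j, hj⟩
  refine ⟨T.perm a.1 k j, eq_vertexPoint_iff.2 ?_⟩
  rw [h2]
  exact eq_vertexPoint_iff.1 hj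

/-- In every simplex, the vertices represent points different from nearby points. -/
theorem eventually_toRealization_ne (t : ι) (i : Fin 4) :
    ∀ᶠ y in 𝓝[≠] (vertexPoint i), ∀ t' i', T.toRealization ⟨t', vertexPoint i'⟩ ≠
      T.toRealization ⟨t, y⟩ := by
  have hc : Continuous fun y : stdSimplex ℝ (Fin 4) => y i :=
    (continuous_apply i).comp continuous_subtype_val
  have h1 : ∀ᶠ y in 𝓝 (vertexPoint i), 0 < y i :=
    hc.continuousAt.eventually (lt_mem_nhds (by simp [vertexPoint_apply_self]))
  filter_upwards [nhdsWithin_le_nhds h1, self_mem_nhdsWithin] with y hy hne t' i' h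
  obtain ⟨j, rfl⟩ := exists_eq_vertexPoint h
  rcases eq_or_ne i j with rfl | hij
  · exact hne rfl
  · rw [vertexPoint_apply_of_ne hij] at hy
    exact hy.false

variable {G : Type*} [Group G] [TopologicalSpace G] {c : ι → Fin 4 → G}

/-- An edge from `i` that lies in face `k` contains points arbitrarily near the vertex. At these the
section obeys the gluing rule, which compares the two germs. -/
theorem IsSection.germ_glue {U : Set T.Realization}
    {s : (Σ _ : ι, stdSimplex ℝ (Fin 4)) → G} (hs : T.IsSection c U s) {t : ι} {i k : Fin 4}
    (hki : k ≠ i) (hU : ∀ᶠ y in 𝓝[≠] (vertexPoint i), T.toRealization ⟨t, y⟩ ∈ U) {g g' : G}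
    (hg : ∀ᶠ y in 𝓝[≠] (vertexPoint i), s ⟨t, y⟩ = g)
    (hg' : ∀ᶠ y in 𝓝[≠] (vertexPoint (T.perm t k i)), s ⟨T.adj t k, y⟩ = g') :
    g' = g * c t k := by
  obtain ⟨l, hil, hkl⟩ : ∃ l, i ≠ l ∧ k ≠ l := by
    clear hg hg' hU
    revert i k
    decide
  have hil' : T.perm t k i ≠ T.perm t k l := (T.perm t k).injective.ne hil
  obtain ⟨δ, h1, h2, h3⟩ := ((tendsto_edgePoint hil).eventually hU).and
    (((tendsto_edgePoint hil).eventually hg).and ((tendsto_edgePoint hil').eventually hg')) |>.exists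
  rw [← h2, ← h3]
  refine hs.map_glue ⟨t, edgePoint hil δ⟩ _ k h1 ?_ rfl fun j => ?_
  · change edgePoint hil δ k = 0
    simp [edgePoint_apply, hki, hkl]
  · change edgePoint hil' δ (T.perm t k j) = edgePoint hil δ j
    simp [edgePoint_apply]

variable [DiscreteTopology G]

/-- A section is locally constant, and punctured neighbourhoods of a corner inside one simplex are
connected. -/
theorem IsSection.exists_germ {U : Set T.Realization}
    {s : (Σ _ : ι, stdSimplex ℝ (Fin 4)) → G} (hs : T.IsSection c U s) {t : ι} {i : Fin 4}
    (hU : ∀ᶠ y in 𝓝[≠] (vertexPoint i), T.toRealization ⟨t, y⟩ ∈ U) :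
    ∃ g, ∀ᶠ y in 𝓝[≠] (vertexPoint i), s ⟨t, y⟩ = g := by
  obtain ⟨ε, hε, hball⟩ := Metric.mem_nhdsWithin_iff.1 hU
  have hmem : Metric.ball (vertexPoint i) ε ∩ {vertexPoint i}ᶜ ∈ 𝓝[≠] (vertexPoint i) :=
    inter_mem (nhdsWithin_le_nhds (Metric.ball_mem_nhds _ hε)) self_mem_nhdsWithin
  have hcont : ContinuousOn (fun y => s ⟨t, y⟩) (Metric.ball (vertexPoint i) ε ∩ {vertexPoint i}ᶜ) :=
    hs.continuousOn.comp continuous_sigmaMk.continuousOn hball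
  rcases (Metric.ball (vertexPoint i) ε ∩ {vertexPoint i}ᶜ).eq_empty_or_nonempty with h | ⟨y, hy⟩
  · exact ⟨1, by filter_upwards [hmem] with y hy; simp [h] at hy⟩
  · refine ⟨s ⟨t, y⟩, ?_⟩
    filter_upwards [hmem] with y' hy'
    exact (isPreconnected_punctured_ball i ε).constant hcont hy' hy

variable {M : Type w} [TopologicalSpace M] [T2Space M] {E : Type*} [NormedAddCommGroup E]
  [NormedSpace ℝ E] [ChartedSpace E M]

/-- Near a vertex of a manifold of dimension at least three, there is no holonomy. -/
theorem exists_vertex_potential [Finite ι] (hE : 3 ≤ Module.finrank ℝ E) (φ : T.Realization ≃ₜ M)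
    (hloc : ∀ x, (∀ t i, T.toRealization ⟨t, vertexPoint i⟩ ≠ x) →
      ∃ V s, IsOpen V ∧ x ∈ V ∧ T.IsSection c V s) :
    ∃ h : ι → Fin 4 → G, ∀ t i k, k ≠ i → h (T.adj t k) (T.perm t k i) = h t i * c t k := by
  have : T2Space T.Realization := φ.symm.t2Space
  have hsec : ∀ v : T.Realization, ∃ U s, insert v U ∈ 𝓝 v ∧ T.IsSection c U s := by
    intro v
    -- There are finitely many vertices, so a small chart around `v` contains no vertex other than
    -- possibly `v`, and `hloc` applies on the punctured chart.
    let S : Set T.Realization := range fun a : ι × Fin 4 => T.toRealization ⟨a.1, vertexPoint a.2⟩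
    have hS : (S \ {v}).Finite := (finite_range _).subset sdiff_subset
    have hO : φ.symm ⁻¹' (S \ {v})ᶜ ∈ 𝓝 (φ v) := by
      refine φ.symm.continuous.continuousAt.preimage_mem_nhds ?_
      rw [φ.symm_apply_apply]
      exact hS.isClosed.isOpen_compl.mem_nhds fun h => h.2 rfl
    obtain ⟨f, hf, hf0, hfO⟩ := ChartedSpace.exists_isOpenEmbedding (E := E) (φ v) hO
    have hf' : IsOpenEmbedding (φ.symm ∘ f) := φ.symm.isOpenEmbedding.comp hf
    have h0 : (φ.symm ∘ f) 0 = v := by simp [hf0]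
    obtain ⟨s, hs⟩ := exists_isSection_image_compl hE hf' (c := c) fun b hb => hloc _ fun t i hti =>
      hfO ⟨b, rfl⟩ ⟨⟨(t, i), hti⟩, fun h => hb (hf'.injective (h.trans h0.symm))⟩
    refine ⟨_, s, ?_, hs⟩
    have hr : insert v ((φ.symm ∘ f) '' {0}ᶜ) = range (φ.symm ∘ f) := by
      rw [← image_univ, ← h0, ← image_insert_eq]
      congr 1
      ext x
      simp [em]
    rw [hr]
    exact hf'.isOpen_range.mem_nhds ⟨0, h0⟩
  choose U s hU hs using hsec
  have hev : ∀ t i v, T.toRealization ⟨t, vertexPoint i⟩ = v →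
      ∀ᶠ y in 𝓝[≠] (vertexPoint i), T.toRealization ⟨t, y⟩ ∈ U v := by
    rintro t i v rfl
    have hc : Continuous fun y => T.toRealization ⟨t, y⟩ :=
      T.isQuotientMap_toRealization.continuous.comp continuous_sigmaMk
    filter_upwards [nhdsWithin_le_nhds (hc.continuousAt.preimage_mem_nhds (hU _)),
      eventually_toRealization_ne t i] with y hy hne
    rcases hy with hy | hy
    · exact absurd hy.symm (hne t i)
    · exact hy
  choose h hh using fun t i v hv => (hs v).exists_germ (hev t i v hv)
  refine ⟨fun t i => h t i _ rfl, fun t i k hki => ?_⟩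
  have hv : T.toRealization ⟨T.adj t k, vertexPoint (T.perm t k i)⟩ =
      T.toRealization ⟨t, vertexPoint i⟩ := by
    refine (toRealization_eq_of_glue (i := k) ?_ rfl fun j => ?_).symm
    · exact vertexPoint_apply_of_ne hki
    · change vertexPoint (T.perm t k i) (T.perm t k j) = vertexPoint i j
      rcases eq_or_ne j i with rfl | hj
      · rw [vertexPoint_apply_self, vertexPoint_apply_self]
      · rw [vertexPoint_apply_of_ne hj]
        exact vertexPoint_apply_of_ne ((T.perm t k).injective.ne hj)
  -- Both corners represent one point `v`, so their germs can be taken from the same section `s v`.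
  have key : ∀ v (hv : T.toRealization ⟨t, vertexPoint i⟩ = v)
      (hv' : T.toRealization ⟨T.adj t k, vertexPoint (T.perm t k i)⟩ = v),
      h (T.adj t k) (T.perm t k i) v hv' = h t i v hv * c t k := fun v hv hv' =>
    (hs v).germ_glue hki (hev t i v hv) (hh t i v hv) (hh _ _ v hv')
  have hirr : ∀ t i v (hv : T.toRealization ⟨t, vertexPoint i⟩ = v), h t i _ rfl = h t i v hv := by
    rintro t i _ rfl
    rfl
  exact (hirr _ _ _ hv).trans (key _ rfl hv)

omit [TopologicalSpace G] [DiscreteTopology G] in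
/-- If a 3-manifold with a triangulation is simply connected, then a group-valued assignment on the
faces that is trivial around every edge is a coboundary. -/
theorem exists_potential [Finite ι] [SimplyConnectedSpace M] (hE : 3 ≤ Module.finrank ℝ E)
    (φ : T.Realization ≃ₜ M)
    (hc : ∀ t i, c (T.adj t i) (T.perm t i i) = (c t i)⁻¹)
    (hedge : ∃ h : ι → Finset (Fin 4) → G, ∀ t A k, A.card = 2 → k ∉ A →
      h (T.adj t k) (A.map (T.perm t k).toEmbedding) = h t A * c t k) :
    ∃ s : ι → G, ∀ t i, s (T.adj t i) = s t * c t i := by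
  classical
  let _ : TopologicalSpace G := ⊥
  have : DiscreteTopology G := ⟨rfl⟩
  have h4 : ∃ h : ι → Finset (Fin 4) → G, ∀ t A k, A.card = 4 → k ∉ A →
      h (T.adj t k) (A.map (T.perm t k).toEmbedding) = h t A * c t k := by
    refine ⟨fun _ _ => 1, fun t A k hA hk => ?_⟩
    rw [Finset.eq_univ_of_card A hA] at hk
    simp at hk
  have h3 : ∃ h : ι → Finset (Fin 4) → G, ∀ t A k, A.card = 3 → k ∉ A →
      h (T.adj t k) (A.map (T.perm t k).toEmbedding) = h t A * c t k := by
    -- An auxiliary order tells the two sides of a face apart: the smaller side gets `1`, the other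
    -- is then forced. The sides differ by `ne_self`.
    let _ : LinearOrder (ι × Fin 4) := linearOrderOfSTO WellOrderingRel
    refine ⟨fun t A => if hA : ∃ k, A = {k}ᶜ then
      (if (t, hA.choose) < (T.adj t hA.choose, T.perm t hA.choose hA.choose) then 1
        else (c t hA.choose)⁻¹) else 1, fun t A k hA hk => ?_⟩
    have hAk : A = {k}ᶜ := by
      refine Finset.eq_of_subset_of_card_le (fun x hx => ?_) ?_
      · simp only [Finset.mem_compl, Finset.mem_singleton]
        rintro rfl
        exact hk hx
      · simp [hA, Finset.card_compl]
    have hAk' : A.map (T.perm t k).toEmbedding = {T.perm t k k}ᶜ := by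
      rw [hAk]
      ext j
      obtain ⟨j, rfl⟩ := (T.perm t k).surjective j
      simp
    have hchoose : ∀ (l : Fin 4) (B : Finset (Fin 4)) (hB : B = {l}ᶜ) (hB' : ∃ k, B = {k}ᶜ),
        hB'.choose = l := fun l B hB hB' => by
      simpa using hB'.choose_spec.symm.trans hB
    dsimp only
    rw [dif_pos (⟨k, hAk⟩ : ∃ k, A = {k}ᶜ), dif_pos (⟨_, hAk'⟩ : ∃ l, A.map (T.perm t k).toEmbedding = {l}ᶜ),
      hchoose k A hAk, hchoose _ _ hAk', T.adj_adj,
      T.perm_adj, hc]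
    have hinv : (T.perm t k)⁻¹ (T.perm t k k) = k := (T.perm t k).symm_apply_apply k
    rw [hinv, inv_inv]
    rcases lt_or_gt_of_ne (T.ne_self t k) with hlt | hlt
    · rw [if_pos hlt, if_neg hlt.not_gt, inv_mul_cancel]
    · rw [if_pos hlt, if_neg hlt.not_gt, one_mul]
  have hstar : ∀ n (a : Σ _ : ι, stdSimplex ℝ (Fin 4)), (∃ A : Finset (Fin 4), A.card = n ∧
      IsDominant a.2 A) → (∃ h : ι → Finset (Fin 4) → G, ∀ t A k, A.card = n → k ∉ A →
      h (T.adj t k) (A.map (T.perm t k).toEmbedding) = h t A * c t k) →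
      ∃ V s, IsOpen V ∧ T.toRealization a ∈ V ∧ T.IsSection c V s := by
    rintro n a ha ⟨h, hh⟩
    obtain ⟨s, hs⟩ := exists_isSection_barycentricStar n h hh
    exact ⟨_, s, isOpen_barycentricStar n, toRealization_mem_barycentricStar.2 ha, hs⟩
  have hloc : ∀ x, (∀ t i, T.toRealization ⟨t, vertexPoint i⟩ ≠ x) →
      ∃ V s, IsOpen V ∧ x ∈ V ∧ T.IsSection c V s := by
    intro x hx
    obtain ⟨a, rfl⟩ := T.toRealization_surjective x
    obtain ⟨A, hne, hA, hsupp⟩ := exists_isDominant_support a.2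
    have h1 : A.card ≠ 1 := by
      intro h
      obtain ⟨i, rfl⟩ := Finset.card_eq_one.1 h
      refine hx a.1 i ?_
      congr 1
      refine Sigma.ext rfl (heq_of_eq ?_)
      symm
      rw [eq_vertexPoint_iff, ← stdSimplex.sum_eq_one a.2]
      refine (Finset.sum_eq_single i (fun j _ hj => ?_) (by simp)).symm
      by_contra h0
      exact hj (Finset.mem_singleton.1 ((hsupp j).2 h0))
    have h0 : 0 < A.card := hne.card_pos
    have h5 : A.card ≤ 4 := by simpa using Finset.card_le_univ A
    obtain h | h | h : A.card = 2 ∨ A.card = 3 ∨ A.card = 4 := by omega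
    · exact hstar 2 a ⟨A, h, hA⟩ hedge
    · exact hstar 3 a ⟨A, h, hA⟩ h3
    · exact hstar 4 a ⟨A, h, hA⟩ h4
  have hvert : ∃ h : ι → Finset (Fin 4) → G, ∀ t A k, A.card = 1 → k ∉ A →
      h (T.adj t k) (A.map (T.perm t k).toEmbedding) = h t A * c t k := by
    obtain ⟨h, hh⟩ := exists_vertex_potential hE φ hloc
    refine ⟨fun t A => if hA : A.Nonempty then h t (A.min' hA) else 1, fun t A k hA hk => ?_⟩
    obtain ⟨i, rfl⟩ := Finset.card_eq_one.1 hA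
    simpa using hh t i k (by simpa using hk)
  have hlocal : ∀ x, ∃ V s, IsOpen V ∧ x ∈ V ∧ T.IsSection c V s := by
    intro x
    by_cases hx : ∀ t i, T.toRealization ⟨t, vertexPoint i⟩ ≠ x
    · exact hloc x hx
    · push Not at hx
      obtain ⟨t, i, rfl⟩ := hx
      obtain ⟨A, hne, hA, hsupp⟩ := exists_isDominant_support (vertexPoint i)
      have hAi : A = {i} := by
        ext j
        rw [hsupp, Finset.mem_singleton]
        rcases eq_or_ne j i with rfl | hj
        · simp [vertexPoint_apply_self]
        · simp [vertexPoint_apply_of_ne hj, hj]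
      exact hstar 1 _ ⟨A, by simp [hAi], hA⟩ hvert
  have : LocallyPathConnectedSpace M := ChartedSpace.locallyPathConnectedSpace E M
  obtain ⟨s, hs⟩ := exists_isSection_range φ.symm.isOpenEmbedding fun b => hlocal (φ.symm b)
  rw [φ.symm.surjective.range_eq] at hs
  -- A global section is constant on each tetrahedron, by connectedness, so it is a function of `t`
  -- alone.
  have hconst : ∀ t y y', s ⟨t, y⟩ = s ⟨t, y'⟩ := by
    intro t y y'
    have hcont : ContinuousOn (fun y => s ⟨t, y⟩) univ :=
      hs.continuousOn.comp continuous_sigmaMk.continuousOn fun _ _ => mem_univ _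
    exact isPreconnected_univ.constant hcont (mem_univ y) (mem_univ y')
  refine ⟨fun t => s ⟨t, vertexPoint 0⟩, fun t i => ?_⟩
  obtain ⟨l, hl⟩ := exists_ne i
  dsimp only
  rw [hconst t _ (vertexPoint l), hconst _ _ (vertexPoint (T.perm t i l))]
  refine hs.map_glue ⟨t, vertexPoint l⟩ _ i (mem_univ _) (vertexPoint_apply_of_ne hl.symm) rfl
    fun j => ?_
  change vertexPoint (T.perm t i l) (T.perm t i j) = vertexPoint l j
  rcases eq_or_ne j l with rfl | hj
  · rw [vertexPoint_apply_self, vertexPoint_apply_self]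
  · rw [vertexPoint_apply_of_ne hj, vertexPoint_apply_of_ne ((T.perm t i).injective.ne hj)]

end FaceGluing

end

/-! ### Combinatorics of rotating flags about an edge. -/

section

open Equiv Function

/-- A function on a finite set with a permutation is a coboundary along a cycle if its product over
the cycle is trivial. -/
theorem Equiv.Perm.exists_potential_of_prod_eq_one {S C : Type*} [Finite S] [CommGroup C]
    (ρ : Perm S) (f₀ : S) (l : S → C)
    (hprod : ∏ i ∈ Finset.range (minimalPeriod ρ f₀), l (ρ^[i] f₀) = 1) :
    ∃ μ : S → C, ∀ f, ρ.SameCycle f₀ f → μ (ρ f) = μ f * l f := by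
  classical
  set N := minimalPeriod ρ f₀ with hN
  have hNpos : 0 < N := minimalPeriod_pos_of_mem_periodicPts
    (ρ.injective.mem_periodicPts f₀)
  let p : ℕ → C := fun n => ∏ i ∈ Finset.range n, l (ρ^[i] f₀)
  -- As the product over a full turn is `1`, the partial products depend only on the flag reached,
  -- and they define `μ`.
  have hper : Periodic p N := by
    intro n
    simp only [p]
    rw [add_comm n N, Finset.prod_range_add, hprod, one_mul]
    refine Finset.prod_congr rfl fun i _ => ?_
    rw [add_comm N i, iterate_add_minimalPeriod_eq]
  have hp : ∀ m n, ρ^[m] f₀ = ρ^[n] f₀ → p m = p n := by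
    intro m n h
    rw [← iterate_mod_minimalPeriod_eq (n := m), ← iterate_mod_minimalPeriod_eq (n := n),
      iterate_eq_iterate_iff_of_lt_minimalPeriod (Nat.mod_lt _ hNpos) (Nat.mod_lt _ hNpos)] at h
    rw [← hper.map_mod_nat m, ← hper.map_mod_nat n, h]
  let μ : S → C := fun f => if h : ∃ n : ℕ, ρ^[n] f₀ = f then p h.choose else 1
  have hμ : ∀ n, μ (ρ^[n] f₀) = p n := by
    intro n
    have h : ∃ m : ℕ, ρ^[m] f₀ = ρ^[n] f₀ := ⟨n, rfl⟩
    simp only [μ]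
    rw [dif_pos h]
    exact hp _ _ h.choose_spec
  refine ⟨μ, fun f hf => ?_⟩
  obtain ⟨n, rfl⟩ := hf.exists_nat_pow_eq
  rw [← Perm.iterate_eq_pow, ← iterate_succ_apply' ρ, hμ, hμ]
  exact Finset.prod_range_succ _ _

namespace FaceGluing

variable {ι : Type u} (T : FaceGluing ι)

/-- A flag is a tetrahedron with an ordering of its vertices. -/
abbrev Flag (ι : Type u) : Type u := ι × Perm (Fin 4)

/-- The exchange of the last two vertices of a flag. -/
def flagSwap : Perm (Flag ι) :=
  Involutive.toPerm (fun f => (f.1, f.2 * swap 2 3)) fun f => by simp [mul_assoc]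

/-- The exchange of the first two vertices of a flag. -/
def flagReverse : Perm (Flag ι) :=
  Involutive.toPerm (fun f => (f.1, f.2 * swap 0 1)) fun f => by simp [mul_assoc]

/-- The passage to the adjacent tetrahedron through the face spanned by the first three vertices. -/
def flagGlue : Perm (Flag ι) :=
  Involutive.toPerm (fun f => (T.adj f.1 (f.2 3), T.perm f.1 (f.2 3) * f.2)) fun f => by
    simp [T.adj_adj, T.perm_adj]

/-- The rotation of a flag about the edge spanned by its first two vertices. -/
def flagRotate : Perm (Flag ι) := T.flagGlue * flagSwap

theorem flagSwap_apply (f : Flag ι) : flagSwap f = (f.1, f.2 * swap 2 3) := rfl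

theorem flagReverse_apply (f : Flag ι) : flagReverse f = (f.1, f.2 * swap 0 1) := rfl

theorem flagGlue_apply (f : Flag ι) :
    T.flagGlue f = (T.adj f.1 (f.2 3), T.perm f.1 (f.2 3) * f.2) := rfl

theorem flagSwap_mul_self : (flagSwap : Perm (Flag ι)) * flagSwap = 1 := by
  ext f : 1
  simp [flagSwap_apply, mul_assoc]

theorem flagGlue_mul_self : T.flagGlue * T.flagGlue = 1 := by
  ext f : 1
  simp [flagGlue_apply, T.adj_adj, T.perm_adj]

theorem commute_flagSwap_flagReverse : Commute (flagSwap : Perm (Flag ι)) flagReverse := by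
  ext f : 1
  have h : (swap 0 1 * swap 2 3 : Perm (Fin 4)) = swap 2 3 * swap 0 1 := by decide
  simp [flagSwap_apply, flagReverse_apply, mul_assoc, h]

theorem commute_flagGlue_flagReverse : Commute T.flagGlue flagReverse := by
  ext f : 1
  have h : (swap 0 1 : Perm (Fin 4)) 3 = 3 := by decide
  simp [flagGlue_apply, flagReverse_apply, mul_assoc, h]

theorem flagSwap_mul_flagRotate : flagSwap * T.flagRotate = T.flagRotate⁻¹ * flagSwap := by
  have h1 : (flagSwap : Perm (Flag ι))⁻¹ = flagSwap := inv_eq_of_mul_eq_one_left flagSwap_mul_self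
  have h2 : T.flagGlue⁻¹ = T.flagGlue := inv_eq_of_mul_eq_one_left T.flagGlue_mul_self
  rw [flagRotate, mul_inv_rev, h1, h2, mul_assoc]

theorem flagRotate_inv_apply (f : Flag ι) : T.flagRotate⁻¹ f = flagSwap (T.flagGlue f) := by
  rw [Perm.inv_eq_iff_eq]
  change f = T.flagGlue (flagSwap (flagSwap (T.flagGlue f)))
  rw [← Perm.mul_apply flagSwap flagSwap, flagSwap_mul_self, Perm.one_apply, ← Perm.mul_apply,
    flagGlue_mul_self, Perm.one_apply]

theorem flagSwap_ne_flagReverse (f : Flag ι) : flagSwap f ≠ flagReverse f := by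
  intro h
  have h1 : f.2 * swap 2 3 = f.2 * swap 0 1 := congrArg Prod.snd h
  exact absurd (mul_left_cancel h1) (by decide)

theorem flagGlue_ne_flagReverse (f : Flag ι) : T.flagGlue f ≠ flagReverse f := by
  intro h
  have h1 : T.adj f.1 (f.2 3) = f.1 := congrArg Prod.fst h
  have h2 : T.perm f.1 (f.2 3) * f.2 = f.2 * swap 0 1 := congrArg Prod.snd h
  refine T.ne_self f.1 (f.2 3) (Prod.ext h1 ?_)
  have h3 := congrArg (fun σ : Perm (Fin 4) => σ 3) h2
  have h4 : (swap 0 1 : Perm (Fin 4)) 3 = 3 := by decide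
  simpa [h4] using h3

/-- Going around an edge, one never returns to the same edge of a tetrahedron with the reversed
direction. -/
theorem not_sameCycle_flagSwap_flagReverse (f : Flag ι) :
    ¬ T.flagRotate.SameCycle f (flagSwap (flagReverse f)) := by
  rintro ⟨n, hn⟩
  -- `flagSwap` and `flagGlue` generate a dihedral action commuting with `flagReverse`. Look at the
  -- flag halfway along the path: for even `n`, swapping would equal reversing there; for odd `n`, a
  -- face would be glued to itself.
  have hconj : ∀ m : ℤ, flagSwap * T.flagRotate ^ m = (T.flagRotate ^ m)⁻¹ * flagSwap := by
    intro m
    have h : SemiconjBy flagSwap T.flagRotate T.flagRotate⁻¹ := T.flagSwap_mul_flagRotate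
    have h' := h.zpow_right m
    rw [inv_zpow] at h'
    exact h'
  have hcomm : ∀ m : ℤ, Commute (T.flagRotate ^ m) flagReverse := fun m =>
    (Commute.mul_left T.commute_flagGlue_flagReverse commute_flagSwap_flagReverse).zpow_left m
  have hss : (flagSwap : Perm (Flag ι)) * flagSwap = 1 := flagSwap_mul_self
  rcases Int.even_or_odd' n with ⟨m, rfl | rfl⟩
  · refine flagSwap_ne_flagReverse ((T.flagRotate ^ m) f) ?_
    have h : flagSwap * T.flagRotate ^ m = T.flagRotate ^ m * flagSwap * T.flagRotate ^ (2 * m) := by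
      rw [hconj m, mul_assoc, hconj (2 * m)]
      group
    rw [← Perm.mul_apply, h, Perm.mul_apply, hn, ← Perm.mul_apply, ← Perm.mul_apply,
      mul_assoc (T.flagRotate ^ m) flagSwap flagSwap, hss, mul_one, (hcomm m).eq, Perm.mul_apply]
  · refine T.flagGlue_ne_flagReverse (flagSwap ((T.flagRotate ^ m) f)) ?_
    have h : T.flagGlue * (flagSwap * T.flagRotate ^ m) =
        flagSwap * (T.flagRotate ^ m * flagSwap * T.flagRotate ^ (2 * m + 1)) := by
      have h1 : T.flagRotate ^ m * flagSwap * T.flagRotate ^ (2 * m + 1) =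
          flagSwap * T.flagRotate * T.flagRotate ^ m := by
        rw [mul_assoc, hconj, mul_assoc flagSwap, ← zpow_one_add, hconj]
        group
      rw [h1, ← mul_assoc, ← mul_assoc, ← mul_assoc, hss, one_mul]
      rfl
    have h' : (T.flagRotate ^ m * flagSwap * T.flagRotate ^ (2 * m + 1) : Perm (Flag ι)) f =
        flagReverse ((T.flagRotate ^ m) f) := by
      rw [Perm.mul_apply, hn, ← Perm.mul_apply, mul_assoc (T.flagRotate ^ m) flagSwap flagSwap, hss,
        mul_one, ← Perm.mul_apply, (hcomm m).eq, Perm.mul_apply]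
    have h'' := DFunLike.congr_fun h f
    rw [Perm.mul_apply, Perm.mul_apply, Perm.mul_apply flagSwap, h'] at h''
    rw [h'', ← Perm.mul_apply, commute_flagSwap_flagReverse.eq, Perm.mul_apply]

/-- The edge spanned by the first two vertices of a flag. -/
def flagEdge (f : Flag ι) : TetEdge ι :=
  (f.1, ⟨{f.2 0, f.2 1}, Finset.card_pair (f.2.injective.ne (by decide))⟩)

theorem flagEdge_flagSwap (f : Flag ι) : flagEdge (flagSwap f) = flagEdge f := by
  have h0 : (swap 2 3 : Perm (Fin 4)) 0 = 0 := by decide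
  have h1 : (swap 2 3 : Perm (Fin 4)) 1 = 1 := by decide
  simp [flagEdge, flagSwap_apply, h0, h1]

theorem notMem_flagEdge (f : Flag ι) {k : Fin 4} :
    k ∉ (flagEdge f).2.1 ↔ k = f.2 2 ∨ k = f.2 3 := by
  obtain ⟨j, rfl⟩ := f.2.surjective k
  have : ∀ j : Fin 4, j ∉ ({0, 1} : Finset (Fin 4)) ↔ j = 2 ∨ j = 3 := by decide
  simpa [flagEdge] using this j

theorem flagEdge_eq_of_edgeRel {f : Flag ι} {a : TetEdge ι} {k : Fin 4} (h1 : a.1 = T.adj f.1 k)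
    (h2 : a.2.1 = (flagEdge f).2.1.map (T.perm f.1 k).toEmbedding) (hk : k = f.2 3) :
    a = flagEdge (T.flagGlue f) := by
  subst hk
  refine Prod.ext h1 (Subtype.ext ?_)
  rw [h2]
  simp [flagEdge, flagGlue_apply]

theorem edgeRel_flagGlue (f : Flag ι) : T.EdgeRel (flagEdge f) (flagEdge (T.flagGlue f)) := by
  refine ⟨f.2 3, (notMem_flagEdge f).2 (Or.inr rfl), rfl, ?_⟩
  simp [flagEdge, flagGlue_apply]

theorem edgeMk_flagRotate (f : Flag ι) :
    T.edgeMk (flagEdge (T.flagRotate f)) = T.edgeMk (flagEdge f) := by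
  rw [← flagEdge_flagSwap f]
  exact (Quot.sound (T.edgeRel_flagGlue (flagSwap f))).symm

/-- The gluing permutation and the swap are both odd. This is where the orientation enters. -/
theorem sign_flagRotate (f : Flag ι) : Perm.sign (T.flagRotate f).2 = Perm.sign f.2 := by
  change Perm.sign (T.perm f.1 ((f.2 * swap 2 3 : Perm (Fin 4)) 3) * (f.2 * swap 2 3)) = _
  rw [map_mul, map_mul, T.sign_perm, Perm.sign_swap (by decide)]
  simp

theorem exists_flagEdge_eq (a : TetEdge ι) : ∃ f : Flag ι, Perm.sign f.2 = 1 ∧ flagEdge f = a := by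
  have : ∀ s : Finset (Fin 4), s.card = 2 → ∃ σ : Perm (Fin 4), Perm.sign σ = 1 ∧
    ({σ 0, σ 1} : Finset (Fin 4)) = s := by decide
  obtain ⟨σ, h1, h2⟩ := this a.2.1 a.2.2
  exact ⟨(a.1, σ), h1, Prod.ext rfl (Subtype.ext h2)⟩

/-- Four flags lie on a given edge of a tetrahedron. Two of them are even, and they differ by
reversing the edge and swapping the other two vertices. -/
theorem eq_or_eq_of_flagEdge_eq {f f' : Flag ι} (hf : Perm.sign f.2 = 1) (hf' : Perm.sign f'.2 = 1)
    (h : flagEdge f' = flagEdge f) : f' = f ∨ f' = flagSwap (flagReverse f) := by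
  have key : ∀ τ : Perm (Fin 4), Perm.sign τ = 1 → ({τ 0, τ 1} : Finset (Fin 4)) = {0, 1} →
    τ = 1 ∨ τ = swap 0 1 * swap 2 3 := by decide
  have h1 : f'.1 = f.1 := congrArg (fun a : TetEdge ι => a.1) h
  have h2 : ({f'.2 0, f'.2 1} : Finset (Fin 4)) = {f.2 0, f.2 1} :=
    congrArg (fun a : TetEdge ι => a.2.1) h
  have h3 : ({(f.2⁻¹ * f'.2) 0, (f.2⁻¹ * f'.2) 1} : Finset (Fin 4)) = {0, 1} := by
    have := congrArg (Finset.map (f.2⁻¹).toEmbedding) h2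
    simpa using this
  rcases key (f.2⁻¹ * f'.2) (by rw [map_mul, Perm.sign_inv, hf, hf', one_mul]) h3 with h4 | h4
  · exact Or.inl (Prod.ext h1 (inv_mul_eq_one.1 h4).symm)
  · refine Or.inr (Prod.ext h1 ?_)
    rw [inv_mul_eq_iff_eq_mul] at h4
    rw [h4, ← mul_assoc]
    rfl

theorem SameCycle.sign_eq {f f' : Flag ι} (h : T.flagRotate.SameCycle f f') :
    Perm.sign f'.2 = Perm.sign f.2 := by
  obtain ⟨n, rfl⟩ := h
  induction n using Int.induction_on with
  | zero => rfl
  | succ n ih => rw [← ih, add_comm, zpow_add, zpow_one, Perm.mul_apply, sign_flagRotate]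
  | pred n ih =>
    rw [← ih, ← sign_flagRotate T ((T.flagRotate ^ (-(n : ℤ) - 1)) f), ← Perm.mul_apply, ← zpow_one_add]
    congr 4
    ring

/-- Two even flags in the same cycle are equal if they contain the same edge of a tetrahedron. -/
theorem SameCycle.eq_of_flagEdge_eq {f f' : Flag ι} (h : T.flagRotate.SameCycle f f')
    (hf : Perm.sign f.2 = 1) (hE : flagEdge f' = flagEdge f) : f' = f := by
  rcases eq_or_eq_of_flagEdge_eq hf ((SameCycle.sign_eq T h).trans hf) hE with h1 | h1
  · exact h1
  · exact absurd (h1 ▸ h) (T.not_sameCycle_flagSwap_flagReverse f)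

theorem edgeRel_symm {a b : TetEdge ι} (h : T.EdgeRel a b) : T.EdgeRel b a := by
  obtain ⟨t, s⟩ := a
  obtain ⟨t', s'⟩ := b
  obtain ⟨k, h0, h1, h2⟩ := h
  dsimp only at h0 h1 h2
  subst h1
  refine ⟨T.perm t k k, ?_, (T.adj_adj t k).symm, ?_⟩
  · simpa [h2] using h0
  · rw [h2, T.perm_adj, Finset.map_map]
    ext j
    simp

/-- Every edge of a tetrahedron in the class of the edge of a flag is obtained by rotating the
flag. -/
theorem exists_sameCycle_flagEdge_eq (f : Flag ι) (a : TetEdge ι)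
    (h : T.edgeMk (flagEdge f) = T.edgeMk a) :
    ∃ f', T.flagRotate.SameCycle f f' ∧ flagEdge f' = a := by
  let P : TetEdge ι → Prop := fun a => ∃ f', T.flagRotate.SameCycle f f' ∧ flagEdge f' = a
  have hP : ∀ a b, T.EdgeRel a b → P a → P b := by
    rintro _ b ⟨k, hk, h1, h2⟩ ⟨f', hf', rfl⟩
    rcases (notMem_flagEdge f').1 hk with hk | hk
    · refine ⟨T.flagRotate f', Perm.sameCycle_apply_right.2 hf', ?_⟩
      have := T.flagEdge_eq_of_edgeRel (f := flagSwap f') (a := b) h1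
        (by rw [h2, flagEdge_flagSwap]; rfl) (by simp [hk, flagSwap_apply])
      exact this.symm
    · refine ⟨T.flagRotate⁻¹ f', hf'.trans ⟨-1, by simp⟩, ?_⟩
      rw [flagRotate_inv_apply, flagEdge_flagSwap]
      exact (T.flagEdge_eq_of_edgeRel h1 h2 hk).symm
  have key : ∀ a b, T.EdgeRel a b → P a = P b := fun a b h =>
    propext ⟨hP a b h, hP b a (T.edgeRel_symm h)⟩
  have h' : Quot.lift P key (T.edgeMk (flagEdge f)) = Quot.lift P key (T.edgeMk a) := by rw [h]
  exact h'.mp ⟨f, Perm.SameCycle.refl _ _, rfl⟩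

/-- The product over the edges of tetrahedra in the class of an edge is the product over the
rotations of a flag. -/
theorem prod_rotate_eq_prod_edge [Fintype ι] {C : Type*} [CommMonoid C] (l : TetEdge ι → C)
    {f : Flag ι} (hf : Perm.sign f.2 = 1) (e : T.Edge) (he : T.edgeMk (flagEdge f) = e)
    [DecidablePred fun a : TetEdge ι => T.edgeMk a = e] :
    ∏ i ∈ Finset.range (minimalPeriod T.flagRotate f), l (flagEdge (T.flagRotate^[i] f)) =
      ∏ a : TetEdge ι with T.edgeMk a = e, l a := by
  have hcyc : ∀ i, T.flagRotate.SameCycle f (T.flagRotate^[i] f) := fun i =>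
    ⟨i, by rw [zpow_natCast, Perm.iterate_eq_pow]⟩
  refine Finset.prod_bij (fun i _ => flagEdge (T.flagRotate^[i] f)) ?_ ?_ ?_ fun _ _ => rfl
  · intro i hi
    simp only [Finset.mem_filter, Finset.mem_univ, true_and]
    clear hi
    induction i with
    | zero => exact he
    | succ i ih => rw [iterate_succ_apply', edgeMk_flagRotate, ih]
  -- Injectivity rests on the exclusion of reversed returns: one full turn meets each edge of a
  -- tetrahedron in the class only once.
  · intro i hi j hj hij
    refine iterate_injOn_Iio_minimalPeriod (Finset.mem_range.1 hi) (Finset.mem_range.1 hj) ?_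
    exact SameCycle.eq_of_flagEdge_eq T ((hcyc j).symm.trans (hcyc i))
      ((SameCycle.sign_eq T (hcyc j)).trans hf) hij
  · intro a ha
    simp only [Finset.mem_filter, Finset.mem_univ, true_and] at ha
    obtain ⟨f', hf', rfl⟩ := T.exists_sameCycle_flagEdge_eq f a (he.trans ha.symm)
    obtain ⟨n, rfl⟩ := hf'.exists_nat_pow_eq
    refine ⟨n % minimalPeriod T.flagRotate f, Finset.mem_range.2 (Nat.mod_lt _ ?_), ?_⟩
    · exact minimalPeriod_pos_of_mem_periodicPts (T.flagRotate.injective.mem_periodicPts f)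
    · rw [iterate_mod_minimalPeriod_eq, Perm.iterate_eq_pow]

/-- If the product around every edge is trivial, then every edge of a tetrahedron can be extended to
an even flag, compatibly with the rotations, and there is a potential. -/
theorem exists_edge_potential [Fintype ι] {C : Type*} [CommGroup C] (l : TetEdge ι → C)
    [∀ e, DecidablePred fun a : TetEdge ι => T.edgeMk a = e]
    (hl : ∀ e, ∏ a : TetEdge ι with T.edgeMk a = e, l a = 1) :
    ∃ (F : TetEdge ι → Flag ι) (μ : TetEdge ι → C), (∀ a, Perm.sign (F a).2 = 1) ∧
      (∀ a, flagEdge (F a) = a) ∧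
      (∀ a, F (flagEdge (T.flagRotate (F a))) = T.flagRotate (F a)) ∧
      (∀ a, F (flagEdge (T.flagRotate⁻¹ (F a))) = T.flagRotate⁻¹ (F a)) ∧
      ∀ a, μ (flagEdge (T.flagRotate (F a))) = μ a * l a := by
  have hbase : ∀ e : T.Edge, ∃ f : Flag ι, Perm.sign f.2 = 1 ∧ T.edgeMk (flagEdge f) = e := by
    intro e
    obtain ⟨a, rfl⟩ := Quot.exists_rep e
    obtain ⟨f, hf, rfl⟩ := exists_flagEdge_eq a
    exact ⟨f, hf, rfl⟩
  choose f₀ hf₀ he₀ using hbase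
  choose F hF hFE using fun a => T.exists_sameCycle_flagEdge_eq (f₀ (T.edgeMk a)) a (he₀ _)
  choose μ hμ using fun e => T.flagRotate.exists_potential_of_prod_eq_one (f₀ e)
    (fun f => l (flagEdge f)) ((T.prod_rotate_eq_prod_edge l (hf₀ e) e (he₀ e)).trans (hl e))
  have hsign : ∀ a, Perm.sign (F a).2 = 1 := fun a => (SameCycle.sign_eq T (hF a)).trans (hf₀ _)
  -- `F` picks, for each edge of a tetrahedron, the only flag on it in the chosen cycle, hence
  -- commutes with rotation.
  have huniq : ∀ a f, T.edgeMk (flagEdge f) = T.edgeMk a → T.flagRotate.SameCycle (F a) f →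
      F (flagEdge f) = f := by
    intro a f he hf
    have h1 : T.flagRotate.SameCycle (f₀ (T.edgeMk a)) (F (flagEdge f)) := by
      rw [← he]
      exact hF _
    refine SameCycle.eq_of_flagEdge_eq T (hf.symm.trans ((hF a).symm.trans h1)) ?_ (hFE _)
    rw [SameCycle.sign_eq T hf, hsign]
  have hrot : ∀ a, T.edgeMk (flagEdge (T.flagRotate (F a))) = T.edgeMk a := fun a => by
    rw [edgeMk_flagRotate, hFE]
  have h1 : ∀ a, F (flagEdge (T.flagRotate (F a))) = T.flagRotate (F a) := fun a =>
    huniq a _ (hrot a) (Perm.sameCycle_apply_right.2 (Perm.SameCycle.refl _ _))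
  refine ⟨F, fun a => μ (T.edgeMk a) (F a), hsign, hFE, h1, fun a => ?_, fun a => ?_⟩
  · refine huniq a _ ?_ ⟨-1, by simp⟩
    rw [← edgeMk_flagRotate, ← Perm.mul_apply, mul_inv_cancel, Perm.one_apply, hFE]
  · dsimp only
    rw [h1, hrot, hμ _ _ (hF a), hFE]

end FaceGluing

end

/-! ### Möbius transformations and cross ratios. -/

section

open Equiv Function
open scoped LinearAlgebra.Projectivization

variable {K : Type*} [Field K]

variable (K) in
/-- The group of Möbius transformations of the projective line. -/
abbrev MobiusGroup : Type _ :=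
  (MulAction.toPermHom ((Fin 2 → K) ≃ₗ[K] (Fin 2 → K)) (ℙ K (Fin 2 → K))).range

namespace MobiusGroup

/-- The Möbius transformation defined by a linear automorphism. -/
def ofLinearEquiv (A : (Fin 2 → K) ≃ₗ[K] (Fin 2 → K)) : MobiusGroup K :=
  ⟨MulAction.toPermHom _ _ A, A, rfl⟩

theorem ofLinearEquiv_mk (A : (Fin 2 → K) ≃ₗ[K] (Fin 2 → K)) {v : Fin 2 → K} (hv : v ≠ 0) :
    (ofLinearEquiv A : Perm (ℙ K (Fin 2 → K))) (.mk K v hv) =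
      .mk K (A v) ((LinearEquiv.map_ne_zero_iff A).2 hv) := rfl

theorem exists_ofLinearEquiv (g : MobiusGroup K) : ∃ A, ofLinearEquiv A = g := by
  obtain ⟨_, A, rfl⟩ := g
  exact ⟨A, rfl⟩

variable (K) in
/-- The points `∞, 0, 1` of the projective line. -/
def basePoint : Fin 3 → ℙ K (Fin 2 → K) :=
  ![.mk K ![1, 0] (by simp), .mk K ![0, 1] (by simp), .mk K ![1, 1] (by simp)]

/-- The vectors `(1,0)`, `(0,1)` and their sum are eigenvectors, so the eigenvalues coincide and `A`
is scalar. -/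
theorem eq_one_of_fix {g : MobiusGroup K} (hg : ∀ j, (g : Perm _) (basePoint K j) = basePoint K j) :
    g = 1 := by
  obtain ⟨A, rfl⟩ := exists_ofLinearEquiv g
  obtain ⟨a, ha⟩ := (Projectivization.mk_eq_mk_iff' _ _ _ _ _).1
    ((ofLinearEquiv_mk A _).symm.trans (hg 0))
  obtain ⟨b, hb⟩ := (Projectivization.mk_eq_mk_iff' _ _ _ _ _).1
    ((ofLinearEquiv_mk A _).symm.trans (hg 1))
  obtain ⟨c, hc⟩ := (Projectivization.mk_eq_mk_iff' _ _ _ _ _).1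
    ((ofLinearEquiv_mk A _).symm.trans (hg 2))
  have h2 : (![1, 1] : Fin 2 → K) = ![1, 0] + ![0, 1] := by simp
  have h3 : c • (![1, 1] : Fin 2 → K) = a • ![1, 0] + b • ![0, 1] := by
    rw [hc, h2, map_add, ha, hb]
  have hca : c = a := by simpa using congrFun h3 0
  have hcb : c = b := by simpa using congrFun h3 1
  have hA : ∀ v, A v = c • v := by
    intro v
    have hv : v = v 0 • ![1, 0] + v 1 • ![0, 1] := by
      ext i
      fin_cases i <;> simp
    rw [hv, map_add, map_smul, map_smul, ← ha, ← hb, ← hca, ← hcb, smul_add, smul_comm c,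
      smul_comm c]
  refine Subtype.ext (Equiv.ext fun p => ?_)
  induction p with
  | h v hv =>
    rw [ofLinearEquiv_mk]
    exact (Projectivization.mk_eq_mk_iff' _ _ _ _ _).2 ⟨c, (hA v).symm⟩

theorem ext_of_basePoint {g g' : MobiusGroup K}
    (h : ∀ j, (g : Perm _) (basePoint K j) = (g' : Perm _) (basePoint K j)) : g = g' := by
  refine inv_mul_eq_one.1 (eq_one_of_fix (g := g⁻¹ * g') fun j => ?_)
  rw [Subgroup.coe_mul, Perm.mul_apply, ← h, ← Perm.mul_apply, ← Subgroup.coe_mul, inv_mul_cancel]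
  rfl

/-- The determinant of two plane vectors. -/
def det₂ (u v : Fin 2 → K) : K := u 0 * v 1 - u 1 * v 0

/-- The Möbius transformation with given images of `∞, 0, 1`. -/
theorem exists_frame (u : Fin 3 → Fin 2 → K) (h01 : det₂ (u 0) (u 1) ≠ 0)
    (h02 : det₂ (u 0) (u 2) ≠ 0) (h21 : det₂ (u 2) (u 1) ≠ 0) :
    ∃ g : MobiusGroup K, ∀ (v : Fin 2 → K) (hv : v ≠ 0) (w : Fin 2 → K) (hw : w ≠ 0),
      (∃ a : K, a • w =
      (v 0 * det₂ (u 2) (u 1)) • u 0 + (v 1 * det₂ (u 0) (u 2)) • u 1) →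
      (g : Perm (ℙ K (Fin 2 → K))) (.mk K v hv) = .mk K w hw := by
  -- The coefficients come from Cramer's rule: `(1,0)` and `(0,1)` go to multiples of `u 0` and `u
  -- 1`, and `(1,1)` goes to `det₂ (u 0) (u 1) • u 2`.
  let f : (Fin 2 → K) →ₗ[K] (Fin 2 → K) :=
    { toFun := fun v => (v 0 * det₂ (u 2) (u 1)) • u 0 + (v 1 * det₂ (u 0) (u 2)) • u 1
      map_add' := fun v w => by simp only [Pi.add_apply, add_mul, add_smul]; abel
      map_smul' := fun a v => by
        simp only [Pi.smul_apply, smul_eq_mul, RingHom.id_apply, smul_add, mul_smul] }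
  have hf : Injective f := by
    rw [injective_iff_map_eq_zero]
    intro v hv
    have e0 : v 0 * det₂ (u 2) (u 1) * u 0 0 + v 1 * det₂ (u 0) (u 2) * u 1 0 = 0 := congrFun hv 0
    have e1 : v 0 * det₂ (u 2) (u 1) * u 0 1 + v 1 * det₂ (u 0) (u 2) * u 1 1 = 0 := congrFun hv 1
    have h0 : v 0 * (det₂ (u 2) (u 1) * det₂ (u 0) (u 1)) = 0 := by
      have : det₂ (u 0) (u 1) = u 0 0 * u 1 1 - u 0 1 * u 1 0 := rfl
      rw [this]
      linear_combination u 1 1 * e0 - u 1 0 * e1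
    have h1 : v 1 * (det₂ (u 0) (u 2) * det₂ (u 0) (u 1)) = 0 := by
      have : det₂ (u 0) (u 1) = u 0 0 * u 1 1 - u 0 1 * u 1 0 := rfl
      rw [this]
      linear_combination u 0 0 * e1 - u 0 1 * e0
    ext i
    fin_cases i
    · exact (mul_eq_zero.1 h0).resolve_right (mul_ne_zero h21 h01)
    · exact (mul_eq_zero.1 h1).resolve_right (mul_ne_zero h02 h01)
  refine ⟨ofLinearEquiv (LinearEquiv.ofInjectiveEndo f hf), fun v hv w hw ⟨a, ha⟩ => ?_⟩
  rw [ofLinearEquiv_mk]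
  exact (Projectivization.mk_eq_mk_iff' _ _ _ _ _).2 ⟨a, ha⟩

/-- The multiplication by a unit as a Möbius transformation. -/
def dilation (a : Kˣ) : MobiusGroup K :=
  ofLinearEquiv (LinearEquiv.piCongrRight fun i => LinearEquiv.smulOfUnit ((![a, 1] : Fin 2 → Kˣ) i))

theorem dilation_mk (a : Kˣ) {v : Fin 2 → K} (hv : v ≠ 0) {w : Fin 2 → K} (hw : w ≠ 0)
    (h : ∃ b : K, b • w = ![a * v 0, v 1]) :
    (dilation a : Perm (ℙ K (Fin 2 → K))) (.mk K v hv) = .mk K w hw := by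
  obtain ⟨b, hb⟩ := h
  rw [dilation, ofLinearEquiv_mk]
  refine (Projectivization.mk_eq_mk_iff' _ _ _ _ _).2 ⟨b, hb.trans ?_⟩
  ext i
  fin_cases i
  · rfl
  · exact (one_mul _).symm

theorem dilation_basePoint_two (a : Kˣ) :
    (dilation a : Perm (ℙ K (Fin 2 → K))) (basePoint K 2) = .mk K ![(a : K), 1] (by simp) :=
  dilation_mk a _ _ ⟨1, by simp⟩

theorem dilation_basePoint_zero (a : Kˣ) :
    (dilation a : Perm (ℙ K (Fin 2 → K))) (basePoint K 0) = basePoint K 0 :=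
  dilation_mk a _ _ ⟨a, by simp⟩

theorem dilation_basePoint_one (a : Kˣ) :
    (dilation a : Perm (ℙ K (Fin 2 → K))) (basePoint K 1) = basePoint K 1 :=
  dilation_mk a _ _ ⟨1, by simp⟩

theorem dilation_mul (a b : Kˣ) : dilation (a * b) = dilation a * dilation b := by
  refine ext_of_basePoint fun j => ?_
  rw [Subgroup.coe_mul, Perm.mul_apply]
  fin_cases j
  · simp [dilation_basePoint_zero]
  · simp [dilation_basePoint_one]
  · simp only [Fin.reduceFinMk, dilation_basePoint_two]
    exact (dilation_mk a _ _ ⟨1, by simp⟩).symm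

/-- The vectors representing the vertices `∞, 0, 1, x` of the ideal simplex with cross ratio `x`. -/
def modelVector (x : K) : Fin 4 → Fin 2 → K := ![![1, 0], ![0, 1], ![1, 1], ![x, 1]]

theorem modelVector_ne_zero (x : K) (i : Fin 4) : modelVector x i ≠ 0 := by
  fin_cases i <;> simp [modelVector]

theorem det₂_modelVector_ne_zero {x : K} (h0 : x ≠ 0) (h1 : x ≠ 1) {i j : Fin 4} (hij : i ≠ j) :
    det₂ (modelVector x i) (modelVector x j) ≠ 0 := by
  have h2 : x - 1 ≠ 0 := sub_ne_zero.2 h1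
  have h3 : 1 - x ≠ 0 := sub_ne_zero.2 h1.symm
  fin_cases i <;> fin_cases j <;>
    first
      | exact absurd rfl hij
      | simp [modelVector, det₂, h0, h2, h3]

/-- The vertices `∞, 0, 1, x` of the ideal simplex with cross ratio `x`. -/
def modelPoint (x : K) (i : Fin 4) : ℙ K (Fin 2 → K) := .mk K (modelVector x i) (modelVector_ne_zero x i)

theorem modelPoint_injective {x : K} (h0 : x ≠ 0) (h1 : x ≠ 1) : Injective (modelPoint x) := by
  intro i j h
  by_contra hij
  obtain ⟨a, ha⟩ := (Projectivization.mk_eq_mk_iff' _ _ _ _ _).1 h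
  refine det₂_modelVector_ne_zero h0 h1 hij ?_
  rw [← ha, det₂, Pi.smul_apply, Pi.smul_apply, smul_eq_mul, smul_eq_mul]
  ring

/-- In the frame given by the first three vertices of an even ordering of the vertices, the last
vertex is the value of a solution at the quad facing the edge between the first two vertices. -/
theorem exists_frame_modelPoint {y : Fin 3 → K} (hy : ∀ q, y (q + 1) * (1 - y q) = 1)
    (σ : Perm (Fin 4)) :
    ∃ g : MobiusGroup K, (∀ j : Fin 3, (g : Perm _) (basePoint K j) =
      modelPoint (y 0) (σ j.castSucc)) ∧ (Perm.sign σ = 1 → ∀ hv, (g : Perm _)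
        (.mk K ![y (FaceGluing.quadFacing {σ 0, σ 1}), 1] hv) = modelPoint (y 0) (σ 3)) := by
  have h01 : y 1 * (1 - y 0) = 1 := hy 0
  have h12 : y 2 * (1 - y 1) = 1 := hy 1
  have h20 : y 0 * (1 - y 2) = 1 := hy 2
  have h0 : y 0 ≠ 0 := left_ne_zero_of_mul_eq_one h20
  have h1 : y 0 ≠ 1 := fun h => by simp [h] at h01
  have hd : ∀ {i j : Fin 4}, i ≠ j →
      det₂ (modelVector (y 0) (σ i)) (modelVector (y 0) (σ j)) ≠ 0 := fun h =>
    det₂_modelVector_ne_zero h0 h1 (σ.injective.ne h)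
  obtain ⟨g, hg⟩ := exists_frame (fun j : Fin 3 => modelVector (y 0) (σ j.castSucc))
    (hd (by decide)) (hd (by decide)) (hd (by decide))
  refine ⟨g, fun j => ?_, fun hσ hv => hg _ _ _ _ ?_⟩
  · fin_cases j
    · refine hg _ _ _ _ ⟨det₂ (modelVector (y 0) (σ 2)) (modelVector (y 0) (σ 1)), ?_⟩
      simp
    · refine hg _ _ _ _ ⟨det₂ (modelVector (y 0) (σ 0)) (modelVector (y 0) (σ 2)), ?_⟩
      simp
    · refine hg _ _ _ _ ⟨det₂ (modelVector (y 0) (σ 0)) (modelVector (y 0) (σ 1)), ?_⟩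
      ext i
      fin_cases i <;> simp [det₂] <;> ring
  -- The cross ratio identity is checked on the twelve even orderings, with `y 1` and `y 2`
  -- expressed through `y 0`.
  · have hperm : ∀ τ : Perm (Fin 4), Perm.sign τ = 1 → (τ 0, τ 1, τ 2, τ 3) ∈
      ([(0, 1, 2, 3), (1, 0, 3, 2), (2, 3, 0, 1), (3, 2, 1, 0), (0, 2, 3, 1), (0, 3, 1, 2),
        (1, 2, 0, 3), (1, 3, 2, 0), (2, 0, 1, 3), (2, 1, 3, 0), (3, 0, 2, 1), (3, 1, 0, 2)] :
        List (Fin 4 × Fin 4 × Fin 4 × Fin 4)) := by decide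
    have e1 : y 1 = (1 - y 0)⁻¹ := eq_inv_of_mul_eq_one_left h01
    have e2 : y 2 = (y 0 - 1) / y 0 := by
      rw [eq_div_iff h0]
      linear_combination -h20
    have h2 : y 0 - 1 ≠ 0 := sub_ne_zero.2 h1
    have h3 : 1 - y 0 ≠ 0 := sub_ne_zero.2 h1.symm
    -- The scalar is found by applying `det₂ (u 0) ·` to both sides, which kills the `u 0` term.
    refine ⟨det₂ (modelVector (y 0) (σ 0)) (modelVector (y 0) (σ 2)) *
      det₂ (modelVector (y 0) (σ 0)) (modelVector (y 0) (σ 1)) /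
      det₂ (modelVector (y 0) (σ 0)) (modelVector (y 0) (σ 3)), ?_⟩
    have hmem := hperm σ hσ
    simp only [List.mem_cons, Prod.mk.injEq, List.not_mem_nil, or_false] at hmem
    have e3 : σ (Fin.castSucc 0) = σ 0 := rfl
    have e4 : σ (Fin.castSucc 1) = σ 1 := rfl
    have e5 : σ (Fin.castSucc 2) = σ 2 := rfl
    rw [e3, e4, e5]
    rcases hmem with ⟨a0, a1, a2, a3⟩ | ⟨a0, a1, a2, a3⟩ | ⟨a0, a1, a2, a3⟩ | ⟨a0, a1, a2, a3⟩ |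
      ⟨a0, a1, a2, a3⟩ | ⟨a0, a1, a2, a3⟩ | ⟨a0, a1, a2, a3⟩ | ⟨a0, a1, a2, a3⟩ |
      ⟨a0, a1, a2, a3⟩ | ⟨a0, a1, a2, a3⟩ | ⟨a0, a1, a2, a3⟩ | ⟨a0, a1, a2, a3⟩ <;>
    · rw [a0, a1, a2, a3]
      ext i
      fin_cases i <;>
        simp [modelVector, det₂, FaceGluing.quadFacing, e1, e2] <;> (try field_simp) <;> (try ring)

end MobiusGroup

end

/-! ### The developing map. -/

section

open Equiv Function
open scoped LinearAlgebra.Projectivization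

namespace FaceGluing

variable {ι : Type u} {T : FaceGluing ι}

section Developing

variable {K : Type*} [Field K]

open MobiusGroup

/-- A Möbius transformation matching the vertices of a face of one model simplex with those of a face
of another is determined by the face. -/
theorem transition_unique {y y' : K} {τ : Perm (Fin 4)} {i : Fin 4} {g g' m : MobiusGroup K}
    {σ : Perm (Fin 4)} (hσ : σ 3 = i)
    (hm : ∀ j : Fin 3, (m : Perm (ℙ K (Fin 2 → K))) (basePoint K j) =
      modelPoint y' (τ (σ j.castSucc)))
    (hg : ∀ k, k ≠ i → (g : Perm (ℙ K (Fin 2 → K))) (modelPoint y' (τ k)) = modelPoint y k)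
    (hg' : ∀ k, k ≠ i → (g' : Perm (ℙ K (Fin 2 → K))) (modelPoint y' (τ k)) = modelPoint y k) :
    g = g' := by
  refine mul_right_cancel (b := m) (ext_of_basePoint fun j => ?_)
  have hj : σ j.castSucc ≠ i := by
    rw [← hσ]
    refine σ.injective.ne ?_
    fin_cases j <;> decide
  rw [Subgroup.coe_mul, Subgroup.coe_mul, Perm.mul_apply, Perm.mul_apply, hm, hg _ hj, hg' _ hj]

/-- On a simply connected closed triangulated manifold, a solution of Thurston's equation in a field
defines a developing map, so that no edge is a loop. -/
theorem not_isLoop_of_isThurstonSolution [Fintype ι] {M E : Type*} [TopologicalSpace M] [T2Space M]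
    [NormedAddCommGroup E] [NormedSpace ℝ E] [ChartedSpace E M] (hE : 3 ≤ Module.finrank ℝ E)
    [SimplyConnectedSpace M] (φ : T.Realization ≃ₜ M) {x : ι → Fin 3 → K}
    (hx : T.IsThurstonSolution x) (e : T.Edge) : ¬ T.IsLoop e := by
  classical
  obtain ⟨hx1, hx2⟩ := hx
  have hne : ∀ t q, x t q ≠ 0 := by
    intro t q
    have h : q - 1 + 1 = q := sub_add_cancel q 1
    exact left_ne_zero_of_mul_eq_one (h ▸ hx1 t (q - 1))
  have hne1 : ∀ t, x t 0 ≠ 1 := fun t h => by simpa [h] using hx1 t 0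
  choose m hm hm3 using fun (f : Flag ι) => exists_frame_modelPoint (hx1 f.1) f.2
  have hinv : ∀ (f : Flag ι) (j : Fin 3), ((m f)⁻¹ : MobiusGroup K).1
      (modelPoint (x f.1 0) (f.2 j.castSucc)) = basePoint K j := fun f j => by
    rw [← hm f j, ← Perm.mul_apply, ← Subgroup.coe_mul, inv_mul_cancel]
    rfl
  let l : TetEdge ι → Kˣ := fun a => Units.mk0 (x a.1 (quadFacing a.2.1)) (hne _ _)
  obtain ⟨F, μ, hF1, hFE, hF, hF', hμ⟩ := T.exists_edge_potential l fun e => by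
    rw [← Units.val_inj, Units.coe_prod, Units.val_one, ← hx2 e, holonomy]
    refine Finset.prod_congr ?_ fun _ _ => rfl
    ext a
    simp
  -- Swapping replaces the image of `1` by the fourth vertex, which is the image of the quad value
  -- under `m f`. The dilation moves `1` to that value and fixes `∞` and `0`.
  have hswap : ∀ f : Flag ι, Perm.sign f.2 = 1 →
      m (flagSwap f) = m f * dilation (l (flagEdge f)) := by
    intro f hf
    refine ext_of_basePoint fun j => ?_
    have h0 : (swap 2 3 : Perm (Fin 4)) 0 = 0 := by decide
    have h1 : (swap 2 3 : Perm (Fin 4)) 1 = 1 := by decide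
    rw [hm, Subgroup.coe_mul, Perm.mul_apply]
    fin_cases j
    · simp only [Fin.zero_eta, dilation_basePoint_zero]
      rw [hm]
      simp [flagSwap_apply, h0]
    · simp only [Fin.mk_one, dilation_basePoint_one]
      rw [hm]
      simp [flagSwap_apply, h1]
    · simp only [Fin.reduceFinMk, dilation_basePoint_two]
      exact (hm3 f hf _).symm
  have htrans : ∀ f : Flag ι, ∀ k, k ≠ f.2 3 →
      ((m f * (m (T.flagGlue f))⁻¹ : MobiusGroup K) : Perm (ℙ K (Fin 2 → K)))
        (modelPoint (x (T.adj f.1 (f.2 3)) 0) (T.perm f.1 (f.2 3) k)) = modelPoint (x f.1 0) k := by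
    intro f k hk
    obtain ⟨j, rfl⟩ := f.2.surjective k
    have hj : ∃ j' : Fin 3, j = j'.castSucc := by
      have : j ≠ Fin.last 3 := fun h => hk (by rw [h]; rfl)
      exact ⟨j.castPred this, by simp⟩
    obtain ⟨j, rfl⟩ := hj
    rw [Subgroup.coe_mul, Perm.mul_apply]
    exact (congrArg _ (hinv (T.flagGlue f) j)).trans (hm f j)
  let flag : ι → Fin 4 → Flag ι := fun t i => (t, swap i 3)
  have hflag : ∀ t i, (flag t i).2 3 = i := fun t i => swap_apply_right i 3
  let c : ι → Fin 4 → MobiusGroup K := fun t i =>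
    m (flag t i) * (m (T.flagGlue (flag t i)))⁻¹
  have hc : ∀ t i k, k ≠ i → (c t i : Perm (ℙ K (Fin 2 → K)))
      (modelPoint (x (T.adj t i) 0) (T.perm t i k)) = modelPoint (x t 0) k := by
    intro t i k hk
    have := htrans (flag t i) k (by rwa [hflag])
    rwa [hflag] at this
  have hcuniq : ∀ t i (g : MobiusGroup K), (∀ k, k ≠ i → (g : Perm (ℙ K (Fin 2 → K)))
      (modelPoint (x (T.adj t i) 0) (T.perm t i k)) = modelPoint (x t 0) k) → c t i = g := by
    intro t i g hg
    refine transition_unique (hflag t i) (m := m (T.flagGlue (flag t i))) ?_ (hc t i) hg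
    intro j
    rw [hm, flagGlue_apply, hflag]
    rfl
  -- By uniqueness on three points, any ordering of the face computes the same transition.
  have hcf : ∀ f : Flag ι, c f.1 (f.2 3) = m f * (m (T.flagGlue f))⁻¹ := fun f =>
    hcuniq _ _ _ (htrans f)
  have hcinv : ∀ t i, c (T.adj t i) (T.perm t i i) = (c t i)⁻¹ := by
    intro t i
    refine hcuniq _ _ _ fun k hk => ?_
    obtain ⟨k, rfl⟩ := (T.perm t i).surjective k
    have hk' : k ≠ i := fun h => hk (by rw [h])
    have h1 : (T.perm t i)⁻¹ (T.perm t i k) = k := (T.perm t i).symm_apply_apply k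
    rw [T.adj_adj, T.perm_adj, h1, ← hc t i k hk', ← Perm.mul_apply, ← Subgroup.coe_mul,
      inv_mul_cancel]
    rfl
  -- In the frame of `F a`, a rotation acts as the dilation by `l a`, so the inverse frame corrected
  -- by the accumulated dilation `μ a` is a potential along the edge.
  obtain ⟨s, hs⟩ := exists_potential hE φ hcinv ⟨fun t A => if hA : A.card = 2 then
      dilation (μ (t, ⟨A, hA⟩)) * (m (F (t, ⟨A, hA⟩)))⁻¹ else 1, fun t A k hA hk => by
    have hA' : (A.map (T.perm t k).toEmbedding).card = 2 := by simpa using hA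
    dsimp only
    rw [dif_pos hA, dif_pos hA']
    obtain ⟨a, ha⟩ : ∃ a : TetEdge ι, a = (t, ⟨A, hA⟩) := ⟨_, rfl⟩
    obtain ⟨b, hb⟩ : ∃ b : TetEdge ι, b = (T.adj t k, ⟨A.map (T.perm t k).toEmbedding, hA'⟩) :=
      ⟨_, rfl⟩
    rw [← ha, ← hb]
    have hfa : flagEdge (F a) = (t, ⟨A, hA⟩) := (hFE a).trans ha
    have h1 : (F a).1 = t := congrArg (fun a : TetEdge ι => a.1) hfa
    have h2 : (flagEdge (F a)).2.1 = A := congrArg (fun a : TetEdge ι => a.2.1) hfa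
    rw [← h2] at hk
    have hb1 : b.1 = T.adj t k := by rw [hb]
    have hb2 : b.2.1 = A.map (T.perm t k).toEmbedding := by rw [hb]
    subst h1
    rcases (notMem_flagEdge _).1 hk with hk | hk
    · have h3 : (flagSwap (F a)).2 3 = k := by simp [hk, flagSwap_apply]
      have hbF : b = flagEdge (T.flagRotate (F a)) := by
        refine T.flagEdge_eq_of_edgeRel (f := flagSwap (F a)) hb1 ?_ h3.symm
        rw [hb2, flagEdge_flagSwap, h2]
        rfl
      have hck : c (F a).1 k = m (flagSwap (F a)) * (m (T.flagRotate (F a)))⁻¹ := by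
        rw [← h3]
        exact hcf (flagSwap (F a))
      rw [hck, hbF, hF, hμ, hswap _ (hF1 a), hFE, dilation_mul]
      group
    · have hbF : b = flagEdge (T.flagRotate⁻¹ (F a)) := by
        rw [flagRotate_inv_apply, flagEdge_flagSwap]
        exact T.flagEdge_eq_of_edgeRel hb1 (by rw [hb2, h2]) hk
      have hFb : F b = T.flagRotate⁻¹ (F a) := by rw [hbF, hF']
      have hFa : T.flagRotate (F b) = F a := by
        rw [hFb, ← Perm.mul_apply, mul_inv_cancel, Perm.one_apply]
      have hμa : μ a = μ b * l b := by rw [← hμ b, hFa, hFE]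
      have hgl : T.flagGlue (F a) = flagSwap (F b) := by
        rw [hFb, flagRotate_inv_apply, ← Perm.mul_apply, flagSwap_mul_self, Perm.one_apply]
      rw [hk, hcf, hgl, hswap _ (hF1 b), hFE, hμa, dilation_mul]
      group⟩
  -- Adjacent tetrahedra develop to simplices that agree on their common face, so `dev` descends to
  -- the vertices of the triangulation.
  let dev : ι × Fin 4 → ℙ K (Fin 2 → K) := fun a => (s a.1).1 (modelPoint (x a.1 0) a.2)
  have hdev : ∀ a b, T.VertexRel a b → dev a = dev b := by
    rintro ⟨t, i⟩ ⟨t', i'⟩ ⟨k, hk, h1, h2⟩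
    dsimp only at hk h1 h2
    subst h1 h2
    simp only [dev]
    rw [hs, ← hc t k i hk.symm]
    rfl
  rintro ⟨t, i, j, hij, -, hv⟩
  have h : dev (t, i) = dev (t, j) := congrArg (Quot.lift dev hdev) hv
  exact hij (modelPoint_injective (hne t 0) (hne1 t) ((s t).1.injective h))

end Developing

/-- The image of a solution under a ring homomorphism is a solution. -/
theorem IsThurstonSolution.map [Fintype ι] {R S : Type*} [CommRing R] [CommRing S] (f : R →+* S)
    {x : ι → Fin 3 → R} (hx : T.IsThurstonSolution x) :
    T.IsThurstonSolution fun t q => f (x t q) := by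
  refine ⟨fun t q => ?_, fun e => ?_⟩
  · simpa using congrArg f (hx.1 t q)
  · rw [← map_one f, ← hx.2 e, holonomy, holonomy, map_prod]

theorem ThurstonSolvable.map [Fintype ι] {R S : Type*} [CommRing R] [CommRing S] (f : R →+* S)
    (h : T.ThurstonSolvable R) : T.ThurstonSolvable S := by
  obtain ⟨x, hx⟩ := h
  exact ⟨_, hx.map f⟩

/-- Reduction modulo a maximal ideal turns the solution into one over a field, where the developing
map is available. -/
theorem not_simplyConnectedSpace_of_thurstonSolvable [Fintype ι] {M E : Type*} [TopologicalSpace M]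
    [T2Space M] [NormedAddCommGroup E] [NormedSpace ℝ E] [ChartedSpace E M]
    (hE : 3 ≤ Module.finrank ℝ E) (φ : T.Realization ≃ₜ M) (hloop : ∃ e : T.Edge, T.IsLoop e)
    {R : Type*} [CommRing R] [Nontrivial R] (h : T.ThurstonSolvable R) :
    ¬ SimplyConnectedSpace M := by
  intro _
  obtain ⟨I, hI⟩ := Ideal.exists_maximal R
  let _ : Field (R ⧸ I) := Ideal.Quotient.field I
  obtain ⟨x, hx⟩ := h.map (Ideal.Quotient.mk I)
  obtain ⟨e, he⟩ := hloop
  exact not_isLoop_of_isThurstonSolution hE φ hx e he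

/-! ### The Thurston ring as the ring of the universal solution. -/

section ThurstonRing

variable [Fintype ι]

/-- The classes of the quads solve the equation tautologically, as its relations generate the ideals
divided out. -/
theorem thurstonSolvable_thurstonRing : T.ThurstonSolvable T.ThurstonRing := by
  let π : TetRingTensor ι →+* T.ThurstonRing := Ideal.Quotient.mk _
  refine ⟨fun t q => π (quadElement t q), fun t q => ?_, fun e => ?_⟩
  · have h : TetRing.mk (MvPolynomial.X (q + 1)) * (1 - TetRing.mk (MvPolynomial.X q)) = 1 := by
      rw [← map_one TetRing.mk, ← map_sub, ← map_mul]
      refine Ideal.Quotient.eq.2 (Ideal.subset_span ⟨q, rfl⟩)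
    rw [← map_one π, ← map_sub, ← map_mul]
    congr 1
    classical
    have h' := congrArg (PiTensorProduct.singleAlgHom (R := ℤ) (A := fun _ : ι => TetRing) t) h
    rw [map_mul, map_sub, map_one] at h'
    convert! h'
  · have h1 : T.holonomy (fun t q => π (quadElement t q)) e = π (T.holonomy quadElement e) := by
      rw [holonomy, holonomy, map_prod]
    rw [h1, ← map_one π]
    exact Ideal.Quotient.eq.2 (Ideal.subset_span ⟨e, rfl⟩)

/-- A solution evaluates each tetrahedron ring in `R`. The product of these evaluations is
multilinear and multiplicative, and it kills the edge relations. -/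
theorem ThurstonSolvable.exists_ringHom {R : Type*} [CommRing R] (h : T.ThurstonSolvable R) :
    Nonempty (T.ThurstonRing →+* R) := by
  classical
  obtain ⟨x, hx1, hx2⟩ := h
  have htet : ∀ t, ∀ p ∈ tetIdeal, MvPolynomial.eval₂Hom (Int.castRingHom R) (x t) p = 0 := by
    intro t
    change tetIdeal ≤ RingHom.ker (MvPolynomial.eval₂Hom (Int.castRingHom R) (x t))
    refine Ideal.span_le.2 ?_
    rintro _ ⟨q, rfl⟩
    simp [RingHom.mem_ker, hx1]
  let f : ι → TetRing →+* R := fun t => Ideal.Quotient.lift tetIdeal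
    (MvPolynomial.eval₂Hom (Int.castRingHom R) (x t)) (htet t)
  have hf : ∀ t q, f t (TetRing.mk (MvPolynomial.X q)) = x t q := by
    intro t q
    refine (Ideal.Quotient.lift_mk _ _ _).trans ?_
    simp
  let F : MultilinearMap ℤ (fun _ : ι => TetRing) R :=
    (MultilinearMap.mkPiAlgebra ℤ ι R).compLinearMap fun t => (f t).toIntAlgHom.toLinearMap
  have hF : ∀ y, F y = ∏ t, f t (y t) := fun y => rfl
  let L : TetRingTensor ι →ₐ[ℤ] R := PiTensorProduct.liftAlgHom F (by simp [hF])
    (fun y z => by simp [hF, Finset.prod_mul_distrib])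
  have hL : ∀ t q, L (quadElement t q) = x t q := by
    intro t q
    have h1 : L (quadElement t q) =
        F (Pi.mulSingle t (TetRing.mk (MvPolynomial.X q))) := by
      rw [quadElement, PiTensorProduct.singleAlgHom_apply]
      refine (PiTensorProduct.lift.tprod _).trans ?_
      congr 1
    rw [h1, hF, Finset.prod_eq_single t]
    · rw [Pi.mulSingle_eq_same, hf]
    · intro j _ hj
      rw [Pi.mulSingle_eq_of_ne hj, map_one]
    · simp
  refine ⟨Ideal.Quotient.lift _ (L : TetRingTensor ι →+* R) ?_⟩
  intro a ha
  rw [← RingHom.mem_ker]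
  refine (Ideal.span_le.2 ?_ : Ideal.span _ ≤ RingHom.ker (L : TetRingTensor ι →+* R)) ha
  rintro _ ⟨e, rfl⟩
  rw [SetLike.mem_coe, RingHom.mem_ker, map_sub, map_one, sub_eq_zero, ← hx2 e, holonomy, holonomy,
    map_prod]
  exact Finset.prod_congr rfl fun a _ => hL _ _

end ThurstonRing

end FaceGluing

end

theorem theorem5p2 {M : Type w} [TopologicalSpace M] [T2Space M] [CompactSpace M]
    [ConnectedSpace M] [ChartedSpace (EuclideanSpace ℝ (Fin 3)) M]
    {ι : Type u} [Fintype ι] (T : FaceGluing ι) (φ : T.Realization ≃ₜ M)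
    (hloop : ∃ e : T.Edge, T.IsLoop e) :
    (Nontrivial T.ThurstonRing → ∀ p : M, Nontrivial (FundamentalGroup M p)) ∧
    (Nontrivial T.ThurstonRing ↔
      ∃ (R : Type (max u v)) (_ : CommRing R), Nontrivial R ∧ T.ThurstonSolvable R) ∧
    (∀ (R : Type v) [CommRing R] [Nontrivial R],
      T.ThurstonSolvable R → ¬ SimplyConnectedSpace M) := by
  have hE : 3 ≤ Module.finrank ℝ (EuclideanSpace ℝ (Fin 3)) := by simp
  refine ⟨fun h p => ?_, ⟨fun h => ?_, ?_⟩, fun R _ _ h => ?_⟩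
  · by_contra hp
    rw [not_nontrivial_iff_subsingleton] at hp
    have : LocallyPathConnectedSpace M :=
      ChartedSpace.locallyPathConnectedSpace (EuclideanSpace ℝ (Fin 3)) M
    have : PathConnectedSpace M := PathConnectedSpace.of_locallyPathConnectedSpace
    refine FaceGluing.not_simplyConnectedSpace_of_thurstonSolvable hE φ hloop
      FaceGluing.thurstonSolvable_thurstonRing ?_
    -- Triviality at `p` passes to every base point `x` along a path, since a connected manifold is
    -- path connected.
    refine simply_connected_iff_loops_nullhomotopic.2 ⟨inferInstance, fun x γ => ?_⟩
    have : Subsingleton (FundamentalGroup M x) :=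
      (FundamentalGroup.fundamentalGroupMulEquivOfPathConnected x p).toEquiv.subsingleton
    exact Path.Homotopic.Quotient.eq.1
      (Subsingleton.elim (α := FundamentalGroup M x) (Path.Homotopic.Quotient.mk γ) 1)
  -- The Thurston ring itself is the witness, lifted only to fit the universe.
  · exact ⟨ULift.{v} T.ThurstonRing, inferInstance, inferInstance,
      FaceGluing.thurstonSolvable_thurstonRing.map ULift.ringEquiv.symm.toRingHom⟩
  · rintro ⟨R, _, _, h⟩
    obtain ⟨f⟩ := h.exists_ringHom
    exact f.domain_nontrivial
  · exact FaceGluing.not_simplyConnectedSpace_of_thurstonSolvable hE φ hloop h
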